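/- Let $n\in\{2,3\}$, let $p\in[3,\infty]$ if $n=3$ and $p\in(2,\infty]$ if $n=2$, let $\delta>\frac{n+1}{2}-\frac np$ (with $n/\infty=0$) and $\mu>2$. For $\sigma\in\mathbb R$ let $L^p_\sigma(\mathbb R^n)$ be the space of $f$ with $(1+|x|^2)^{\sigma/2}f\in L^p(\mathbb R^n)$, and let $H^1_\sigma(\mathbb R^n)$ be the space of complex-valued $f\in L^2_\sigma$ whose weak gradient $\nabla f$ belongs to $L^2_\sigma$. Let $W:\mathbb R^n\to\mathbb R^n$ and $V:\mathbb R^n\to\mathbb R$ satisfy $W\in L^\infty_\delta(\mathbb R^n)$, $V\in L^p_{\rm loc}(\mathbb R^n)$, suppose that the weak divergence $\nabla\cdot W$ exists and belongs to $L^p_\delta(\mathbb R^n)$, and that for some constants $c,R$ $$|V(x)|,\ |W(x)|,\ |\nabla\cdot W(x)|\le \frac{c}{|x|^{\mu}}\qquad\text{for almost all } |x|\ge R .$$ Put $\tilde q=|W|^2+V$ and, for $k>0$ and $r>0$, $$G_k^+(r)=\frac i4\Big(\frac{k}{2\pi r}\Big)^{\frac{n-2}{2}}H^{(1)}_{\frac{n-2}{2}}(kr),$$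 where $H^{(1)}_\nu$ is the Hankel function of the first kind, so that $G_k^+(|x-y|)$ is the kernel of $(-\Delta-k^2-i0)^{-1}$. For a function $f$ let $$Sf=i\,\nabla\cdot(Wf)+i\,W\cdot\nabla f-\tilde q f,\qquad L_kf(x)=\int_{\mathbb R^n}G_k^+(|x-y|)\,Sf(y)\,dy,$$ with weak derivatives. Let $\frac12<\delta_0<\frac{\mu-1}{2}$ (such $\delta_0$ exist since $\mu>2$). Then for every $k>0$ and every $f\in H^1_{-\delta_0}(\mathbb R^n)$ the weak divergence $\nabla\cdot(Wf)$ exists, $Sf\in L^1(\mathbb R^n)$, the integral defining $L_kf(x)$ converges absolutely for all $x$ with $|x|$ sufficiently large, and $$L_kf(x)=c_n\,\frac{e^{ik|x|}k^{\frac{n-3}{2}}}{|x|^{\frac{n-1}{2}}}\int_{\mathbb R^n}e^{-ik(\theta',y)}\,Sf(y)\,dy+o\Big(\frac1{|x|^{\frac{n-1}{2}}}\Big),\qquad |x|\to\infty,\quad \theta'=\frac{x}{|x|},$$ where the remainder is uniform in the direction $\theta'$ and $c_n=\dfrac{e^{-i\pi(n-3)/4}}{2(2\pi)^{(n-1)/2}}$,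 that is, $c_3=\frac1{4\pi}$ and $c_2=\frac{e^{i\pi/4}}{\sqrt{8\pi}}$. -/

import Mathlib

open MeasureTheory Asymptotics Bornology
open scoped ContDiff ENNReal

noncomputable section

namespace MagneticScattering

/-- `ℝⁿ` with the Euclidean norm. -/
abbrev Rn (n : ℕ) : Type := EuclideanSpace ℝ (Fin n)

/-- `𝕜`-valued vector fields take values in `𝕜ⁿ` with the Euclidean norm. -/
abbrev Vec (𝕜 : Type) (n : ℕ) : Type := EuclideanSpace 𝕜 (Fin n)

/-! ### Bessel and Hankel functions of a positive argument -/

/-- Bessel function of the first kind `J_ν(z)`, for real `ν` and `z > 0`, by the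
Bessel–Schläfli integral. -/
def besselJ (ν z : ℝ) : ℝ :=
  (1 / Real.pi) * (∫ θ in (0 : ℝ)..Real.pi, Real.cos (z * Real.sin θ - ν * θ))
    - (Real.sin (ν * Real.pi) / Real.pi)
      * ∫ t in Set.Ioi (0 : ℝ), Real.exp (-z * Real.sinh t - ν * t)

/-- Bessel function of the second kind `Y_ν(z)`, for real `ν` and `z > 0`, by the
Bessel–Schläfli integral. -/
def besselY (ν z : ℝ) : ℝ :=
  (1 / Real.pi) * (∫ θ in (0 : ℝ)..Real.pi, Real.sin (z * Real.sin θ - ν * θ))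
    - (1 / Real.pi)
      * ∫ t in Set.Ioi (0 : ℝ),
          (Real.exp (ν * t) + Real.exp (-ν * t) * Real.cos (ν * Real.pi))
            * Real.exp (-z * Real.sinh t)

/-- Hankel function of the first kind, `H_ν^{(1)} = J_ν + i Y_ν`. -/
def hankelH1 (ν z : ℝ) : ℂ := (besselJ ν z : ℂ) + Complex.I * (besselY ν z : ℂ)

/-- The outgoing kernel `G_k^+(r)` of `(-Δ - k² - i0)⁻¹` on `ℝⁿ`,
`(i/4) (k / (2πr))^{(n-2)/2} H^{(1)}_{(n-2)/2}(kr)`. -/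
def greenFn (n : ℕ) (k r : ℝ) : ℂ :=
  (Complex.I / 4) * (((k / (2 * Real.pi * r)) ^ (((n : ℝ) - 2) / 2) : ℝ) : ℂ)
    * hankelH1 (((n : ℝ) - 2) / 2) (k * r)

/-- The dimensional constant `c_n = e^{-iπ(n-3)/4} / (2 (2π)^{(n-1)/2})`; so `c_3 = 1/(4π)` and
`c_2 = e^{iπ/4} / √(8π)`. -/
def farFieldConst (n : ℕ) : ℂ :=
  Complex.exp (-(Complex.I * (Real.pi : ℂ) * (((n : ℂ) - 3) / 4)))
    / ((2 * (2 * Real.pi) ^ (((n : ℝ) - 1) / 2) : ℝ) : ℂ)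

/-! ### Weak derivatives and weighted spaces -/

/-- The classical partial derivative `∂_i φ (x)`. -/
def pderiv {n : ℕ} (i : Fin n) (φ : Rn n → ℝ) (x : Rn n) : ℝ :=
  fderiv ℝ φ x (EuclideanSpace.single i (1 : ℝ))

/-- Real-valued test functions, `φ ∈ C_c^∞(ℝⁿ)`. -/
def IsTestFn {n : ℕ} (φ : Rn n → ℝ) : Prop := ContDiff ℝ ∞ φ ∧ HasCompactSupport φ

/-- `g` is the weak (distributional) gradient of `f`. -/
def IsWeakGrad {n : ℕ} (f : Rn n → ℂ) (g : Rn n → Vec ℂ n) : Prop :=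
  LocallyIntegrable f volume ∧ LocallyIntegrable g volume ∧
    ∀ φ : Rn n → ℝ, IsTestFn φ → ∀ i : Fin n,
      ∫ x, pderiv i φ x • f x = -∫ x, φ x • g x i

/-- `d` is the weak (distributional) divergence of the vector field `F`. -/
def IsWeakDiv {𝕜 : Type} [RCLike 𝕜] {n : ℕ} (F : Rn n → Vec 𝕜 n) (d : Rn n → 𝕜) : Prop :=
  LocallyIntegrable F volume ∧ LocallyIntegrable d volume ∧
    ∀ φ : Rn n → ℝ, IsTestFn φ →
      ∫ x, ∑ i : Fin n, pderiv i φ x • F x i = -∫ x, φ x • d x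

open Classical in
/-- The weak gradient `∇f` (determined up to a null set when it exists; `0` otherwise). -/
def weakGrad {n : ℕ} (f : Rn n → ℂ) : Rn n → Vec ℂ n :=
  if h : ∃ g, IsWeakGrad f g then h.choose else 0

open Classical in
/-- The weak divergence `∇ · F` (determined up to a null set when it exists; `0` otherwise). -/
def weakDiv {n : ℕ} (F : Rn n → Vec ℂ n) : Rn n → ℂ :=
  if h : ∃ d, IsWeakDiv F d then h.choose else 0

/-- `f ∈ L^p_σ(ℝⁿ)`, i.e. `(1 + |x|²)^{σ/2} f ∈ L^p(ℝⁿ)`. -/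
def MemWeightedLp {n : ℕ} {F : Type} [NormedAddCommGroup F] [NormedSpace ℝ F]
    (p : ℝ≥0∞) (σ : ℝ) (f : Rn n → F) : Prop :=
  MemLp (fun x => ((1 + ‖x‖ ^ 2) ^ (σ / 2) : ℝ) • f x) p volume

/-- `f ∈ H^1_σ(ℝⁿ)`: both `f` and its weak gradient belong to `L²_σ(ℝⁿ)`. -/
def MemWeightedH1 {n : ℕ} (σ : ℝ) (f : Rn n → ℂ) : Prop :=
  MemWeightedLp 2 σ f ∧ ∃ g, IsWeakGrad f g ∧ MemWeightedLp 2 σ g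

/-- `|g(x)| ≤ c |x|^{-μ}` for (almost) all large `|x|`. -/
def DecaysLike {n : ℕ} {F : Type} [NormedAddCommGroup F] (μ : ℝ) (g : Rn n → F) : Prop :=
  ∃ c R : ℝ, ∀ᵐ x : Rn n, R ≤ ‖x‖ → ‖g x‖ ≤ c / ‖x‖ ^ μ

/-- The assumptions on the magnetic potential `W` and the electric potential `V`. -/
structure Admissible {n : ℕ} (p : ℝ≥0∞) (δ μ : ℝ) (W : Rn n → Rn n) (V : Rn n → ℝ) : Prop where
  /-- `W ∈ L^∞_δ`. -/
  W_mem : MemWeightedLp ⊤ δ W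
  /-- `∇ · W` exists weakly, belongs to `L^p_δ` and decays like `|x|^{-μ}`. -/
  divW : ∃ d : Rn n → ℝ, IsWeakDiv (𝕜 := ℝ) W d ∧ MemWeightedLp p δ d ∧ DecaysLike μ d
  /-- `V ∈ L^p_loc`. -/
  V_mem : ∀ K : Set (Rn n), IsCompact K → MemLp V p (volume.restrict K)
  /-- `W` decays like `|x|^{-μ}`. -/
  W_decay : DecaysLike μ W
  /-- `V` decays like `|x|^{-μ}`. -/
  V_decay : DecaysLike μ V

/-! ### The integral operator -/

/-- The complex vector field `W f`. -/
def mulField {n : ℕ} (W : Rn n → Rn n) (f : Rn n → ℂ) (x : Rn n) : Vec ℂ n :=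
  WithLp.toLp 2 fun i => (W x i : ℂ) * f x

/-- `i ∇·(W f) + i W·∇f - q̃ f` with `q̃ = |W|² + V`. -/
def source {n : ℕ} (W : Rn n → Rn n) (V : Rn n → ℝ) (f : Rn n → ℂ) (y : Rn n) : ℂ :=
  Complex.I * weakDiv (mulField W f) y
    + Complex.I * (∑ i : Fin n, (W y i : ℂ) * weakGrad f y i)
    - ((‖W y‖ ^ 2 + V y : ℝ) : ℂ) * f y

/-- The operator `L_k f(x) = ∫ G_k^+(|x - y|) (i ∇·(W f) + i W·∇f - q̃ f)(y) dy`. -/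
def Lk {n : ℕ} (W : Rn n → Rn n) (V : Rn n → ℝ) (k : ℝ) (f : Rn n → ℂ) (x : Rn n) : ℂ :=
  ∫ y, greenFn n k ‖x - y‖ * source W V f y

/-- `∫ e^{-ik(θ, y)} (i ∇·(W f) + i W·∇f - q̃ f)(y) dy`. -/
def farFieldIntegral {n : ℕ} (W : Rn n → Rn n) (V : Rn n → ℝ) (k : ℝ) (f : Rn n → ℂ)
    (θ : Rn n) : ℂ :=
  ∫ y, Complex.exp (-(Complex.I * (k : ℂ) * ((inner ℝ θ y : ℝ) : ℂ))) * source W V f y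

end MagneticScattering

end

open MagneticScattering

/-!
With `d = ∇·W`, the product rule gives `Sf = (i d - |W|² - V) f + 2i W·∇f`. Since the coefficients
decay like `|x|^{-μ}` while `f` and `∇f` lie in `L²_{-δ₀}`, near infinity `Sf` lies in `L²_a` with
`a = μ - δ₀ > n/2`; hence `Sf` is integrable. The product rule itself holds for a weakly
differentiable `f` and a merely bounded `W` because mollifying `W` commutes with the divergence.

The Hankel function of order `|ν| ≤ 1/2` is a sum of two oscillatory Schläfli integrals, handled by
stationary phase at an endpoint, and of a tail of smaller order; this gives both the leading
term and the bound `|G_k^+(r)| ≤ C r^{-(n-1)/2}` for all `r > 0`.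

Split the integral at `|x - y| = |x|/2`. On the far part `|x|^{(n-1)/2} G_k^+(|x - y|)` is bounded
and `|x - y| = |x| - (θ', y) + O(|x|⁻¹)` for fixed `y`, so dominated convergence applies, uniformly
in the direction. On the near part `|y| ≥ |x|/2`, and Cauchy–Schwarz bounds the contribution by
`C |x|^{1/2 - a} = o(|x|^{-(n-1)/2})`.
-/

namespace MagneticScattering

open Filter Topology Set
open scoped Real InnerProductSpace

/-! ### The Fresnel integral -/

theorem continuous_exp_neg_mul_sq (b : ℂ) :
    Continuous fun u : ℝ => Complex.exp (-b * (u : ℂ) ^ 2) := by fun_prop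

theorem norm_exp_neg_mul_sq_le {b : ℂ} (hb : 0 ≤ b.re) (u : ℝ) :
    ‖Complex.exp (-b * (u : ℂ) ^ 2)‖ ≤ 1 := by
  rw [Complex.norm_exp, ← Complex.ofReal_pow, Complex.re_mul_ofReal, Complex.neg_re]
  exact Real.exp_le_one_iff.2 (by nlinarith [sq_nonneg u])

theorem norm_exp_neg_mul_sq_div_le {b : ℂ} (hb : 0 ≤ b.re) (hb1 : 1 ≤ ‖b‖) (u : ℝ) {c : ℝ}
    (hc : 0 < c) : ‖Complex.exp (-b * (u : ℂ) ^ 2) / (2 * b * c)‖ ≤ 1 / (2 * c) := by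
  have hexp := norm_exp_neg_mul_sq_le hb u
  simp only [norm_div, norm_mul, Complex.norm_real, Real.norm_eq_abs, abs_of_pos hc,
    Complex.norm_ofNat]
  gcongr
  nlinarith

theorem hasDerivAt_exp_neg_mul_sq_div {b : ℂ} (hb : b ≠ 0) {u : ℝ} (hu : u ≠ 0) :
    HasDerivAt (fun v : ℝ => Complex.exp (-b * (v : ℂ) ^ 2) / (2 * b * v))
      (-(Complex.exp (-b * (u : ℂ) ^ 2)
        + Complex.exp (-b * (u : ℂ) ^ 2) / (2 * b * (u ^ 2 : ℝ)))) u := by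
  have hu' : (u : ℂ) ≠ 0 := by exact_mod_cast hu
  have hid : HasDerivAt (fun v : ℝ => (v : ℂ)) 1 u := Complex.ofRealCLM.hasDerivAt
  have hquot := (((hid.pow 2).const_mul (-b)).cexp).div (hid.const_mul (2 * b)) (by simp [hb, hu'])
  refine hquot.congr_deriv ?_
  simp only [Pi.pow_apply]
  push_cast
  field_simp
  ring

/-- Integrating by parts once: `∫_X^u e^{-bs²} ds + e^{-bu²} / (2bu)` has derivative of norm at most
`1 / (2u²)`. -/
theorem norm_integral_exp_neg_mul_sq_le {b : ℂ} (hb : 0 ≤ b.re) (hb1 : 1 ≤ ‖b‖) {X Y : ℝ}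
    (hX : 0 < X) (hXY : X ≤ Y) :
    ‖∫ u in X..Y, Complex.exp (-b * (u : ℂ) ^ 2)‖ ≤ 1 / X := by
  have hb0 : b ≠ 0 := norm_pos_iff.1 (zero_lt_one.trans_le hb1)
  set E : ℝ → ℂ := fun u => Complex.exp (-b * (u : ℂ) ^ 2) with hE
  have hcont : Continuous E := continuous_exp_neg_mul_sq b
  have hpos : ∀ u ∈ Icc X Y, 0 < u := fun u hu => hX.trans_le hu.1
  have hderiv : ∀ u ∈ Icc X Y, HasDerivAt (fun v => (∫ s in X..v, E s) + E v / (2 * b * v))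
      (-(E u / (2 * b * (u ^ 2 : ℝ)))) u := fun u hu =>
    ((intervalIntegral.integral_hasDerivAt_right (hcont.intervalIntegrable _ _)
      hcont.stronglyMeasurable.stronglyMeasurableAtFilter hcont.continuousAt).add
      (hasDerivAt_exp_neg_mul_sq_div hb0 (hpos u hu).ne')).congr_deriv (by simp only [hE]; ring)
  have hmajorant : ∀ u ∈ Icc X Y,
      HasDerivAt (fun v : ℝ => 1 / X - 1 / (2 * v)) (1 / (2 * u ^ 2)) u := fun u hu => by
    have hu0 := (hpos u hu).ne'
    have hinv := (((hasDerivAt_id u).const_mul 2).inv (by simpa using hu0)).const_sub (1 / X)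
    simp only [Pi.inv_apply, id, ← one_div] at hinv
    exact hinv.congr_deriv (by field_simp)
  have hbound : ‖(∫ s in X..Y, E s) + E Y / (2 * b * Y)‖ ≤ 1 / X - 1 / (2 * Y) := by
    refine image_norm_le_of_norm_deriv_right_le_deriv_boundary'
      (fun u hu => (hderiv u hu).continuousAt.continuousWithinAt)
      (fun u hu => (hderiv u (Ico_subset_Icc_self hu)).hasDerivWithinAt) ?_
      (fun u hu => (hmajorant u hu).continuousAt.continuousWithinAt)
      (fun u hu => (hmajorant u (Ico_subset_Icc_self hu)).hasDerivWithinAt) (fun u hu => ?_)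
      (right_mem_Icc.2 hXY)
    · rw [intervalIntegral.integral_same, zero_add]
      exact (norm_exp_neg_mul_sq_div_le hb hb1 X hX).trans_eq (by field_simp; norm_num)
    · rw [norm_neg]
      exact norm_exp_neg_mul_sq_div_le hb hb1 u (pow_pos (hpos u (Ico_subset_Icc_self hu)) 2)
  have hboundary := norm_exp_neg_mul_sq_div_le hb hb1 Y (hX.trans_le hXY)
  calc ‖∫ s in X..Y, E s‖
      = ‖((∫ s in X..Y, E s) + E Y / (2 * b * Y)) - E Y / (2 * b * Y)‖ := by
        rw [add_sub_cancel_right]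
    _ ≤ (1 / X - 1 / (2 * Y)) + 1 / (2 * Y) := (norm_sub_le _ _).trans (add_le_add hbound hboundary)
    _ = 1 / X := sub_add_cancel _ _

theorem norm_gaussian_sub_integral_le {b : ℂ} (hb : 0 < b.re) (hb1 : 1 ≤ ‖b‖) {X : ℝ}
    (hX : 0 < X) :
    ‖(π / b) ^ (1 / 2 : ℂ) / 2 - ∫ u in (0 : ℝ)..X, Complex.exp (-b * (u : ℂ) ^ 2)‖
      ≤ 1 / X := by
  have hInt : Integrable fun u : ℝ => Complex.exp (-b * (u : ℂ) ^ 2) :=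
    integrable_cexp_neg_mul_sq hb
  have hlim := intervalIntegral_tendsto_integral_Ioi 0 hInt.integrableOn tendsto_id
  rw [integral_gaussian_complex_Ioi hb] at hlim
  refine le_of_tendsto (hlim.sub_const _).norm ?_
  filter_upwards [eventually_ge_atTop X] with Y hY
  rw [id, intervalIntegral.integral_interval_sub_left hInt.intervalIntegrable
    hInt.intervalIntegrable]
  exact norm_integral_exp_neg_mul_sq_le hb.le hb1 hX hY

/-- The Fresnel integral `∫₀^X e^{-iu²} du`. -/
noncomputable def fresnel (X : ℝ) : ℂ :=
  ∫ u in (0 : ℝ)..X, Complex.exp (-Complex.I * (u : ℂ) ^ 2)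

/-- The value `∫₀^∞ e^{-iu²} du = (√π / 2) e^{-iπ/4}` of the improper Fresnel integral. -/
noncomputable def fresnelLim : ℂ := (√π / 2 : ℝ) * Complex.exp (-(π / 4 : ℝ) * Complex.I)

theorem gaussian_I_eq_fresnelLim : ((π : ℂ) / Complex.I) ^ (1 / 2 : ℂ) / 2 = fresnelLim := by
  have hsqrt : Complex.exp ((Real.log π : ℂ) * (1 / 2)) = (√π : ℝ) := by
    rw [Real.sqrt_eq_rpow, Real.rpow_def_of_pos Real.pi_pos]
    push_cast
    rfl
  rw [Complex.div_I, ← mul_neg, Complex.cpow_def_of_ne_zero (by simp [Real.pi_ne_zero]),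
    Complex.log_ofReal_mul Real.pi_pos (by simp), Complex.log_neg_I, fresnelLim, add_mul,
    Complex.exp_add, hsqrt]
  push_cast
  rw [show -(π / 2 : ℂ) * Complex.I * (1 / 2) = -(π / 4 : ℂ) * Complex.I by ring]
  ring

/-- The Gaussian estimate for `b = ε + i` is uniform in `ε`, so it survives the limit `ε → 0⁺`. -/
theorem norm_fresnelLim_sub_le {X : ℝ} (hX : 0 < X) : ‖fresnelLim - fresnel X‖ ≤ 1 / X := by
  have hint : Continuous fun ε : ℝ =>
      ∫ u in (0 : ℝ)..X, Complex.exp (-((ε : ℂ) + Complex.I) * (u : ℂ) ^ 2) :=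
    intervalIntegral.continuous_parametric_intervalIntegral_of_continuous' (by fun_prop) _ _
  have hgauss : ContinuousAt (fun ε : ℝ =>
      ((π : ℂ) / ((ε : ℂ) + Complex.I)) ^ (1 / 2 : ℂ) / 2) 0 := by
    refine ContinuousAt.div_const (ContinuousAt.cpow ?_ continuousAt_const ?_) _
    · exact continuousAt_const.div (by fun_prop) (by simp)
    · simp [Complex.mem_slitPlane_iff, Real.pi_ne_zero]
  have hlim := ((hgauss.sub hint.continuousAt).norm.tendsto).mono_left
    (nhdsWithin_le_nhds (s := Ioi (0 : ℝ)))
  simp only [Pi.sub_apply, Complex.ofReal_zero, zero_add, gaussian_I_eq_fresnelLim] at hlim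
  refine le_of_tendsto hlim ?_
  filter_upwards [self_mem_nhdsWithin] with ε hε
  refine norm_gaussian_sub_integral_le (by simpa using hε) ?_ hX
  calc (1 : ℝ) = |((ε : ℂ) + Complex.I).im| := by simp
    _ ≤ _ := Complex.abs_im_le_norm _

theorem tendsto_fresnel : Tendsto fresnel atTop (𝓝 fresnelLim) := by
  rw [tendsto_iff_norm_sub_tendsto_zero]
  refine squeeze_zero' (Eventually.of_forall fun _ => norm_nonneg _) ?_
    (tendsto_inv_atTop_zero (𝕜 := ℝ))
  filter_upwards [eventually_gt_atTop 0] with X hX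
  rw [norm_sub_rev, ← one_div]
  exact norm_fresnelLim_sub_le hX

theorem norm_fresnel_le {X : ℝ} (hX : 0 ≤ X) : ‖fresnel X‖ ≤ ‖fresnelLim‖ + 1 := by
  rcases le_total X 1 with h | h
  · have hlen : ‖fresnel X‖ ≤ 1 * |X - 0| :=
      intervalIntegral.norm_integral_le_of_norm_le_const fun u _ =>
        norm_exp_neg_mul_sq_le (by simp) u
    rw [sub_zero, abs_of_nonneg hX] at hlen
    linarith [norm_nonneg fresnelLim]
  · have hdist := norm_fresnelLim_sub_le (zero_lt_one.trans_le h)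
    have hinv : 1 / X ≤ 1 := (div_le_one (by linarith)).2 h
    have htri := norm_sub_norm_le (fresnel X) fresnelLim
    rw [norm_sub_rev] at htri
    linarith

theorem hasDerivAt_fresnel (X : ℝ) :
    HasDerivAt fresnel (Complex.exp (-Complex.I * (X : ℂ) ^ 2)) X :=
  intervalIntegral.integral_hasDerivAt_right
    ((continuous_exp_neg_mul_sq _).intervalIntegrable _ _)
    (continuous_exp_neg_mul_sq _).stronglyMeasurable.stronglyMeasurableAtFilter
    (continuous_exp_neg_mul_sq _).continuousAt

theorem continuous_fresnel : Continuous fresnel :=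
  continuous_iff_continuousAt.2 fun X => (hasDerivAt_fresnel X).continuousAt

/-! ### Stationary phase at an endpoint -/

section EndpointStationaryPhase

variable {L : ℝ} {θ θ' : ℝ → ℝ} {a a' : ℝ → ℂ}

theorem mul_integral_exp_neg_mul_sq_eq (hL : 0 ≤ L)
    (hθ : ∀ φ ∈ Icc 0 L, HasDerivAt θ (θ' φ) φ) (hθ' : ContinuousOn θ' (Icc 0 L))
    (ha : ∀ φ ∈ Icc 0 L, HasDerivAt a (a' φ) φ) (ha' : ContinuousOn a' (Icc 0 L))
    (hθ0 : θ 0 = 0) (r : ℝ) :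
    r * ∫ φ in (0 : ℝ)..L, Complex.exp (-Complex.I * (r * θ φ : ℝ) ^ 2) * θ' φ * a φ
      = fresnel (r * θ L) * a L - ∫ φ in (0 : ℝ)..L, fresnel (r * θ φ) * a' φ := by
  rw [← uIcc_of_le hL] at hθ hθ' ha ha'
  have hθcont : ContinuousOn θ (uIcc 0 L) := fun φ hφ => (hθ φ hφ).continuousAt.continuousWithinAt
  have hF : ∀ φ ∈ uIcc 0 L, HasDerivAt (fun φ => fresnel (r * θ φ))
      ((r * θ' φ : ℝ) • Complex.exp (-Complex.I * (r * θ φ : ℝ) ^ 2)) φ := fun φ hφ =>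
    HasDerivAt.scomp (g₁ := fresnel) φ (hasDerivAt_fresnel (r * θ φ)) ((hθ φ hφ).const_mul r)
  have hF' : IntervalIntegrable
      (fun φ => (r * θ' φ : ℝ) • Complex.exp (-Complex.I * (r * θ φ : ℝ) ^ 2)) volume 0 L :=
    ContinuousOn.intervalIntegrable (by fun_prop)
  have hparts := intervalIntegral.integral_mul_deriv_eq_deriv_mul hF ha hF' ha'.intervalIntegrable
  have hfresnel0 : fresnel (r * θ 0) = 0 := by simp [fresnel, hθ0]
  rw [hparts, hfresnel0, zero_mul, sub_zero, sub_sub_cancel, ← intervalIntegral.integral_const_mul]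
  refine intervalIntegral.integral_congr fun φ _ => ?_
  simp only [Complex.real_smul, Complex.ofReal_mul]
  ring

theorem norm_mul_integral_exp_neg_mul_sq_le (hL : 0 ≤ L)
    (hθ : ∀ φ ∈ Icc 0 L, HasDerivAt θ (θ' φ) φ) (hθ' : ContinuousOn θ' (Icc 0 L))
    (ha : ∀ φ ∈ Icc 0 L, HasDerivAt a (a' φ) φ) (ha' : ContinuousOn a' (Icc 0 L))
    (hθ0 : θ 0 = 0) (hθpos : ∀ φ ∈ Ioc 0 L, 0 < θ φ) {r : ℝ} (hr : 0 ≤ r) :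
    ‖r * ∫ φ in (0 : ℝ)..L, Complex.exp (-Complex.I * (r * θ φ : ℝ) ^ 2) * θ' φ * a φ‖
      ≤ (‖fresnelLim‖ + 1) * (‖a L‖ + ∫ φ in (0 : ℝ)..L, ‖a' φ‖) := by
  have hθnonneg : 0 ≤ θ L := by
    rcases hL.eq_or_lt with rfl | hL'
    · exact hθ0.ge
    · exact (hθpos L (right_mem_Ioc.2 hL')).le
  rw [mul_integral_exp_neg_mul_sq_eq hL hθ hθ' ha ha' hθ0, mul_add,
    ← intervalIntegral.integral_const_mul]
  refine (norm_sub_le _ _).trans (add_le_add ?_ ?_)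
  · rw [norm_mul]
    exact mul_le_mul_of_nonneg_right (norm_fresnel_le (mul_nonneg hr hθnonneg)) (norm_nonneg _)
  · refine intervalIntegral.norm_integral_le_of_norm_le hL (Eventually.of_forall fun φ hφ => ?_) ?_
    · rw [norm_mul]
      exact mul_le_mul_of_nonneg_right (norm_fresnel_le (mul_nonneg hr (hθpos φ hφ).le))
        (norm_nonneg _)
    · rw [← uIcc_of_le hL] at ha'
      exact (continuousOn_const.mul ha'.norm).intervalIntegrable

theorem tendsto_mul_integral_exp_neg_mul_sq (hL : 0 < L)
    (hθ : ∀ φ ∈ Icc 0 L, HasDerivAt θ (θ' φ) φ) (hθ' : ContinuousOn θ' (Icc 0 L))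
    (ha : ∀ φ ∈ Icc 0 L, HasDerivAt a (a' φ) φ) (ha' : ContinuousOn a' (Icc 0 L))
    (hθ0 : θ 0 = 0) (hθpos : ∀ φ ∈ Ioc 0 L, 0 < θ φ) :
    Tendsto (fun r : ℝ =>
        r * ∫ φ in (0 : ℝ)..L, Complex.exp (-Complex.I * (r * θ φ : ℝ) ^ 2) * θ' φ * a φ)
      atTop (𝓝 (fresnelLim * a 0)) := by
  simp only [mul_integral_exp_neg_mul_sq_eq hL.le hθ hθ' ha ha' hθ0]
  have hfresnel : ∀ φ ∈ Ioc 0 L, Tendsto (fun r : ℝ => fresnel (r * θ φ)) atTop (𝓝 fresnelLim) :=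
    fun φ hφ => tendsto_fresnel.comp (tendsto_id.atTop_mul_const (hθpos φ hφ))
  have hθcont : ContinuousOn θ (Ioc 0 L) := fun φ hφ =>
    (hθ φ (Ioc_subset_Icc_self hφ)).continuousAt.continuousWithinAt
  have hInt : IntervalIntegrable a' volume 0 L :=
    ContinuousOn.intervalIntegrable (by rwa [uIcc_of_le hL.le])
  have hint : Tendsto (fun r : ℝ => ∫ φ in (0 : ℝ)..L, fresnel (r * θ φ) * a' φ) atTop
      (𝓝 (∫ φ in (0 : ℝ)..L, fresnelLim * a' φ)) := by
    refine intervalIntegral.tendsto_integral_filter_of_dominated_convergence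
      (fun φ => (‖fresnelLim‖ + 1) * ‖a' φ‖) (Eventually.of_forall fun r => ?_) ?_
      (hInt.norm.const_mul _) (Eventually.of_forall fun φ hφ => ?_)
    · rw [uIoc_of_le hL.le]
      exact ((continuous_fresnel.comp_continuousOn (continuousOn_const.mul hθcont)).mul
        (ha'.mono Ioc_subset_Icc_self)).aestronglyMeasurable measurableSet_Ioc
    · filter_upwards [eventually_ge_atTop 0] with r hr
      refine Eventually.of_forall fun φ hφ => ?_
      rw [uIoc_of_le hL.le] at hφ
      rw [norm_mul]
      exact mul_le_mul_of_nonneg_right (norm_fresnel_le (mul_nonneg hr (hθpos φ hφ).le))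
        (norm_nonneg _)
    · rw [uIoc_of_le hL.le] at hφ
      exact (hfresnel φ hφ).mul_const _
  have hftc : ∫ φ in (0 : ℝ)..L, a' φ = a L - a 0 :=
    intervalIntegral.integral_eq_sub_of_hasDerivAt (by rwa [uIcc_of_le hL.le]) hInt
  have hlim := ((hfresnel L (right_mem_Ioc.2 hL)).mul_const (a L)).sub hint
  rwa [intervalIntegral.integral_const_mul, hftc, ← mul_sub, sub_sub_cancel] at hlim

end EndpointStationaryPhase

/-! ### The oscillating part of the Hankel function -/

/-- The quarter-period Schläfli integral `∫₀^{π/2} e^{i(z cos φ - νφ)} dφ`; its only stationary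
point is the endpoint `φ = 0`. -/
noncomputable def schlafliHalf (ν z : ℝ) : ℂ :=
  ∫ φ in (0 : ℝ)..(π / 2), Complex.exp (Complex.I * (z * Real.cos φ - ν * φ : ℝ))

/-- The amplitude `e^{-iνφ} / cos (φ/2)` of the Schläfli integral in the variable
`sin (φ/2)`, which makes the phase exactly quadratic. -/
noncomputable def schlafliAmp (ν φ : ℝ) : ℂ :=
  Complex.exp (-Complex.I * ν * φ) / (Real.cos (φ / 2) : ℝ)

/-- The derivative of `schlafliAmp`. -/
noncomputable def schlafliAmpDeriv (ν φ : ℝ) : ℂ :=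
  (Complex.exp (-Complex.I * ν * φ) * (-Complex.I * ν) * (Real.cos (φ / 2) : ℝ)
    - Complex.exp (-Complex.I * ν * φ) * (-Real.sin (φ / 2) * (1 / 2) : ℝ))
    / ((Real.cos (φ / 2) : ℝ) : ℂ) ^ 2

theorem cos_half_ne_zero {φ : ℝ} (h : φ ∈ Icc 0 (π / 2)) : Real.cos (φ / 2) ≠ 0 := by
  refine (Real.cos_pos_of_mem_Ioo ⟨?_, ?_⟩).ne' <;> linarith [h.1, h.2, Real.pi_pos]

theorem sin_half_pos {φ : ℝ} (h : φ ∈ Ioc 0 (π / 2)) : 0 < Real.sin (φ / 2) := by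
  refine Real.sin_pos_of_pos_of_lt_pi ?_ ?_ <;> linarith [h.1, h.2, Real.pi_pos]

theorem hasDerivAt_sin_half (φ : ℝ) :
    HasDerivAt (fun u : ℝ => Real.sin (u / 2)) (Real.cos (φ / 2) * (1 / 2)) φ :=
  ((hasDerivAt_id φ).div_const 2).sin

theorem hasDerivAt_schlafliAmp (ν : ℝ) {φ : ℝ} (h : φ ∈ Icc 0 (π / 2)) :
    HasDerivAt (schlafliAmp ν) (schlafliAmpDeriv ν φ) φ := by
  have hid : HasDerivAt (fun u : ℝ => (u : ℂ)) 1 φ := Complex.ofRealCLM.hasDerivAt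
  have hcos : HasDerivAt (fun u : ℝ => Real.cos (u / 2)) (-Real.sin (φ / 2) * (1 / 2)) φ :=
    ((hasDerivAt_id φ).div_const 2).cos
  have hquot := ((hid.const_mul (-Complex.I * ν)).cexp).div hcos.ofReal_comp
    (by exact_mod_cast cos_half_ne_zero h)
  rw [mul_one] at hquot
  exact hquot

theorem continuousOn_schlafliAmpDeriv (ν : ℝ) :
    ContinuousOn (schlafliAmpDeriv ν) (Icc 0 (π / 2)) :=
  ContinuousOn.div (by fun_prop) (by fun_prop) fun _ h =>
    pow_ne_zero _ (by exact_mod_cast cos_half_ne_zero h)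

theorem exp_neg_mul_exp_schlafli_phase (ν : ℝ) {z : ℝ} (hz : 0 ≤ z) (φ : ℝ) :
    Complex.exp (-Complex.I * z) * Complex.exp (Complex.I * (z * Real.cos φ - ν * φ : ℝ))
      = Complex.exp (-Complex.I * (√(2 * z) * Real.sin (φ / 2) : ℝ) ^ 2)
        * Complex.exp (-Complex.I * ν * φ) := by
  have hcos : Real.cos φ = 1 - 2 * Real.sin (φ / 2) ^ 2 := by
    rw [Real.sin_sq_eq_half_sub, mul_div_cancel₀ _ (two_ne_zero' ℝ)]
    ring
  rw [← Complex.exp_add, ← Complex.exp_add, hcos, ← Complex.ofReal_pow, mul_pow,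
    Real.sq_sqrt (by positivity)]
  congr 1
  push_cast
  ring

theorem sqrt_mul_schlafliHalf (ν : ℝ) {z : ℝ} (hz : 0 ≤ z) :
    (√z : ℂ) * Complex.exp (-Complex.I * z) * schlafliHalf ν z
      = √2 * (√(2 * z) * ∫ φ in (0 : ℝ)..(π / 2),
          Complex.exp (-Complex.I * (√(2 * z) * Real.sin (φ / 2) : ℝ) ^ 2)
            * (Real.cos (φ / 2) * (1 / 2) : ℝ) * schlafliAmp ν φ) := by
  have hsqrt : (√2 : ℂ) * √(2 * z) = 2 * √z := by
    rw [Real.sqrt_mul zero_le_two]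
    push_cast
    rw [← mul_assoc, ← Complex.ofReal_mul, Real.mul_self_sqrt zero_le_two]
    norm_num
  rw [schlafliHalf, ← mul_assoc (√2 : ℂ), hsqrt, ← intervalIntegral.integral_const_mul,
    ← intervalIntegral.integral_const_mul]
  refine intervalIntegral.integral_congr fun φ hφ => ?_
  have hcos : ((Real.cos (φ / 2) : ℝ) : ℂ) ≠ 0 := by
    rw [uIcc_of_le (by positivity)] at hφ
    exact_mod_cast cos_half_ne_zero hφ
  simp only [mul_assoc, exp_neg_mul_exp_schlafli_phase ν hz φ, schlafliAmp]
  push_cast at hcos ⊢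
  field_simp

theorem exists_norm_sqrt_mul_schlafliHalf_le (ν : ℝ) :
    ∃ C : ℝ, ∀ z : ℝ, 0 ≤ z → √z * ‖schlafliHalf ν z‖ ≤ C := by
  refine ⟨√2 * ((‖fresnelLim‖ + 1) * (‖schlafliAmp ν (π / 2)‖
    + ∫ φ in (0 : ℝ)..(π / 2), ‖schlafliAmpDeriv ν φ‖)), fun z hz => ?_⟩
  have hnorm : √z * ‖schlafliHalf ν z‖
      = ‖(√z : ℂ) * Complex.exp (-Complex.I * z) * schlafliHalf ν z‖ := by
    simp [Complex.norm_exp, abs_of_nonneg (Real.sqrt_nonneg z)]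
  rw [hnorm, sqrt_mul_schlafliHalf ν hz, norm_mul, Complex.norm_real,
    Real.norm_of_nonneg (Real.sqrt_nonneg 2)]
  gcongr
  exact norm_mul_integral_exp_neg_mul_sq_le (by positivity) (fun φ _ => hasDerivAt_sin_half φ)
    (by fun_prop) (fun φ => hasDerivAt_schlafliAmp ν) (continuousOn_schlafliAmpDeriv ν)
    (by simp) (fun φ => sin_half_pos) (Real.sqrt_nonneg _)

theorem tendsto_sqrt_mul_schlafliHalf (ν : ℝ) :
    Tendsto (fun z : ℝ => (√z : ℂ) * Complex.exp (-Complex.I * z) * schlafliHalf ν z)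
      atTop (𝓝 (√2 * fresnelLim)) := by
  have hsqrt : Tendsto (fun z : ℝ => √(2 * z)) atTop atTop :=
    Real.tendsto_sqrt_atTop.comp (tendsto_id.const_mul_atTop two_pos)
  have hphase := ((tendsto_mul_integral_exp_neg_mul_sq (by positivity)
    (fun φ _ => hasDerivAt_sin_half φ) (by fun_prop) (fun φ => hasDerivAt_schlafliAmp ν)
    (continuousOn_schlafliAmpDeriv ν) (by simp) (fun φ => sin_half_pos)).comp
    hsqrt).const_mul (√2 : ℂ)
  have hamp : schlafliAmp ν 0 = 1 := by simp [schlafliAmp]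
  rw [hamp, mul_one] at hphase
  refine hphase.congr' ?_
  filter_upwards [eventually_ge_atTop 0] with z hz
  exact (sqrt_mul_schlafliHalf ν hz).symm

/-! ### The decaying part of the Hankel function -/

theorem image_sinh_half_Ioi : (fun t : ℝ => Real.sinh (t / 2)) '' Ioi 0 = Ioi 0 := by
  ext u
  constructor
  · rintro ⟨t, ht, rfl⟩
    exact Real.sinh_pos_iff.2 (half_pos ht)
  · intro hu
    refine ⟨2 * Real.arsinh u, mul_pos two_pos (Real.arsinh_pos_iff.2 hu), ?_⟩
    simp only [mul_div_cancel_left₀ _ (two_ne_zero' ℝ), Real.sinh_arsinh]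

theorem injOn_sinh_half (s : Set ℝ) : InjOn (fun t : ℝ => Real.sinh (t / 2)) s :=
  (Real.sinh_injective.comp fun _ _ h => (div_left_inj' two_ne_zero).1 h).injOn

theorem hasDerivAt_sinh_half (t : ℝ) :
    HasDerivAt (fun t : ℝ => Real.sinh (t / 2)) (Real.cosh (t / 2) * (1 / 2)) t :=
  ((hasDerivAt_id t).div_const 2).sinh

theorem abs_cosh_half_smul_eq (z t : ℝ) :
    |Real.cosh (t / 2) * (1 / 2)| • Real.exp (-(2 * z) * Real.sinh (t / 2) ^ 2)
      = 1 / 4 * (2 * Real.cosh (t / 2) * Real.exp (-(2 * z) * Real.sinh (t / 2) ^ 2)) := by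
  rw [abs_of_pos (mul_pos (Real.cosh_pos _) (by norm_num)), smul_eq_mul]
  ring

theorem integrableOn_cosh_half_mul_exp {z : ℝ} (hz : 0 < z) :
    IntegrableOn (fun t => 2 * Real.cosh (t / 2) * Real.exp (-(2 * z) * Real.sinh (t / 2) ^ 2))
      (Ioi 0) := by
  have hgauss : IntegrableOn (fun u : ℝ => Real.exp (-(2 * z) * u ^ 2)) (Ioi 0) :=
    (integrable_exp_neg_mul_sq (by positivity)).integrableOn
  rw [← image_sinh_half_Ioi, integrableOn_image_iff_integrableOn_abs_deriv_smul measurableSet_Ioi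
    (fun t _ => (hasDerivAt_sinh_half t).hasDerivWithinAt) (injOn_sinh_half _)] at hgauss
  simp only [abs_cosh_half_smul_eq] at hgauss
  exact (integrable_const_mul_iff (by norm_num) _).1 hgauss

theorem integral_cosh_half_mul_exp (z : ℝ) :
    ∫ t in Ioi (0 : ℝ), 2 * Real.cosh (t / 2) * Real.exp (-(2 * z) * Real.sinh (t / 2) ^ 2)
      = 2 * √(π / (2 * z)) := by
  have hgauss := integral_gaussian_Ioi (2 * z)
  rw [← image_sinh_half_Ioi, integral_image_eq_integral_abs_deriv_smul measurableSet_Ioi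
    (fun t _ => (hasDerivAt_sinh_half t).hasDerivWithinAt) (injOn_sinh_half _)] at hgauss
  simp only [abs_cosh_half_smul_eq, integral_const_mul] at hgauss
  linarith

theorem exp_half_mul_exp_neg_mul_sinh_le {z t : ℝ} (hz : 0 ≤ z) (ht : 0 ≤ t) :
    Real.exp (t / 2) * Real.exp (-z * Real.sinh t)
      ≤ 2 * Real.cosh (t / 2) * Real.exp (-(2 * z) * Real.sinh (t / 2) ^ 2) := by
  have hsinh : 2 * Real.sinh (t / 2) ^ 2 ≤ Real.sinh t := by
    have hdouble := Real.sinh_two_mul (t / 2)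
    rw [mul_div_cancel₀ _ (two_ne_zero' ℝ)] at hdouble
    nlinarith [Real.sinh_nonneg_iff.2 (div_nonneg ht zero_le_two), Real.sinh_lt_cosh (t / 2)]
  gcongr ?_ * Real.exp ?_
  · rw [Real.cosh_eq]
    linarith [Real.exp_pos (-(t / 2))]
  · nlinarith

theorem integrableOn_exp_half_mul_exp_neg_mul_sinh {z : ℝ} (hz : 0 < z) :
    IntegrableOn (fun t => Real.exp (t / 2) * Real.exp (-z * Real.sinh t)) (Ioi 0) := by
  refine Integrable.mono' (integrableOn_cosh_half_mul_exp hz)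
    (Continuous.aestronglyMeasurable (by fun_prop)) ?_
  filter_upwards [ae_restrict_mem measurableSet_Ioi] with t ht
  rw [Real.norm_of_nonneg (by positivity)]
  exact exp_half_mul_exp_neg_mul_sinh_le hz.le (le_of_lt ht)

theorem integral_exp_half_mul_exp_neg_mul_sinh_le_sqrt {z : ℝ} (hz : 0 < z) :
    ∫ t in Ioi (0 : ℝ), Real.exp (t / 2) * Real.exp (-z * Real.sinh t) ≤ 2 * √(π / (2 * z)) :=
  (setIntegral_mono_on (integrableOn_exp_half_mul_exp_neg_mul_sinh hz)
    (integrableOn_cosh_half_mul_exp hz) measurableSet_Ioi fun _ ht =>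
      exp_half_mul_exp_neg_mul_sinh_le hz.le (le_of_lt ht)).trans_eq (integral_cosh_half_mul_exp z)

theorem integral_exp_half_mul_exp_neg_mul_sinh_le_div {z : ℝ} (hz : 1 ≤ z) :
    ∫ t in Ioi (0 : ℝ), Real.exp (t / 2) * Real.exp (-z * Real.sinh t) ≤ 2 / z := by
  have hz0 : 0 < z := by linarith
  have hneg : -(z / 2) < 0 := by linarith
  calc ∫ t in Ioi (0 : ℝ), Real.exp (t / 2) * Real.exp (-z * Real.sinh t)
      ≤ ∫ t in Ioi (0 : ℝ), Real.exp (-(z / 2) * t) := by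
        refine setIntegral_mono_on (integrableOn_exp_half_mul_exp_neg_mul_sinh hz0)
          (integrableOn_exp_mul_Ioi hneg 0) measurableSet_Ioi fun t ht => ?_
        have ht0 : (0 : ℝ) < t := ht
        rw [← Real.exp_add]
        gcongr
        nlinarith [mul_le_mul_of_nonneg_left (Real.self_le_sinh_iff.2 ht0.le) hz0.le]
    _ = 2 / z := by
        rw [integral_exp_mul_Ioi hneg, mul_zero, Real.exp_zero]
        field_simp

/-- The non-oscillating part of the Schläfli representation of `H_ν^{(1)}`. -/
noncomputable def hankelTail (ν z : ℝ) : ℂ :=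
  -((Real.sin (ν * π) / π * ∫ t in Ioi (0 : ℝ), Real.exp (-z * Real.sinh t - ν * t) : ℝ) : ℂ)
    - Complex.I * ((1 / π * ∫ t in Ioi (0 : ℝ),
        (Real.exp (ν * t) + Real.exp (-ν * t) * Real.cos (ν * π)) * Real.exp (-z * Real.sinh t)
          : ℝ) : ℂ)

theorem exp_mul_le_exp_half {ν t : ℝ} (hν : |ν| ≤ 1 / 2) (ht : 0 ≤ t) :
    Real.exp (ν * t) ≤ Real.exp (t / 2) :=
  Real.exp_le_exp.2 (by nlinarith [le_abs_self ν])

theorem norm_hankelTail_integrand_le {ν t : ℝ} (hν : |ν| ≤ 1 / 2) (ht : 0 ≤ t) (z : ℝ) :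
    ‖(Real.exp (ν * t) + Real.exp (-ν * t) * Real.cos (ν * π)) * Real.exp (-z * Real.sinh t)‖
      ≤ 2 * (Real.exp (t / 2) * Real.exp (-z * Real.sinh t)) := by
  rw [norm_mul, Real.norm_of_nonneg (Real.exp_pos (-z * Real.sinh t)).le, ← mul_assoc, two_mul]
  gcongr
  refine (norm_add_le _ _).trans (add_le_add ?_ ?_)
  · rw [Real.norm_of_nonneg (Real.exp_pos _).le]
    exact exp_mul_le_exp_half hν ht
  · rw [norm_mul, Real.norm_of_nonneg (Real.exp_pos _).le]
    exact (mul_le_of_le_one_right (Real.exp_pos _).le (Real.abs_cos_le_one _)).trans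
      (exp_mul_le_exp_half (by rwa [abs_neg]) ht)

theorem norm_hankelTail_le {ν : ℝ} (hν : |ν| ≤ 1 / 2) {z : ℝ} (hz : 0 < z) :
    ‖hankelTail ν z‖ ≤ ∫ t in Ioi (0 : ℝ), Real.exp (t / 2) * Real.exp (-z * Real.sinh t) := by
  set T := ∫ t in Ioi (0 : ℝ), Real.exp (t / 2) * Real.exp (-z * Real.sinh t) with hT
  have hInt := integrableOn_exp_half_mul_exp_neg_mul_sinh hz
  have hT0 : 0 ≤ T := integral_nonneg fun t => by positivity
  have hJ : ‖∫ t in Ioi (0 : ℝ), Real.exp (-z * Real.sinh t - ν * t)‖ ≤ T := by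
    refine norm_integral_le_of_norm_le hInt ?_
    filter_upwards [ae_restrict_mem measurableSet_Ioi] with t ht
    rw [Real.norm_of_nonneg (Real.exp_pos _).le, sub_eq_add_neg, add_comm, ← neg_mul, Real.exp_add]
    exact mul_le_mul_of_nonneg_right (exp_mul_le_exp_half (by rwa [abs_neg]) (le_of_lt ht))
      (Real.exp_pos _).le
  have hY : ‖∫ t in Ioi (0 : ℝ), (Real.exp (ν * t) + Real.exp (-ν * t) * Real.cos (ν * π))
      * Real.exp (-z * Real.sinh t)‖ ≤ 2 * T := by
    rw [hT, ← integral_const_mul]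
    refine norm_integral_le_of_norm_le (hInt.const_mul 2) ?_
    filter_upwards [ae_restrict_mem measurableSet_Ioi] with t ht
    exact norm_hankelTail_integrand_le hν (le_of_lt ht) z
  refine (norm_sub_le _ _).trans ?_
  rw [norm_neg, norm_mul, Complex.norm_I, one_mul, Complex.norm_real, Complex.norm_real, norm_mul,
    norm_mul, norm_div, norm_div, norm_one, Real.norm_of_nonneg Real.pi_pos.le]
  calc ‖Real.sin (ν * π)‖ / π * ‖∫ t in Ioi (0 : ℝ), Real.exp (-z * Real.sinh t - ν * t)‖ + _
      ≤ 1 / π * T + 1 / π * (2 * T) := by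
        gcongr
        exact Real.abs_sin_le_one _
    _ = 3 * T / π := by ring
    _ ≤ T := by
        rw [div_le_iff₀ Real.pi_pos]
        nlinarith [Real.pi_gt_three]

/-! ### The Hankel function -/

theorem integral_schlafli_eq (ν z : ℝ) :
    ∫ θ in (0 : ℝ)..π, Complex.exp (Complex.I * (z * Real.sin θ - ν * θ : ℝ))
      = Complex.exp (-Complex.I * (ν * (π / 2) : ℝ))
        * (schlafliHalf ν z + schlafliHalf (-ν) z) := by
  set F : ℝ → ℂ := fun θ => Complex.exp (Complex.I * (z * Real.sin θ - ν * θ : ℝ)) with hF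
  have hcont : Continuous F := by fun_prop
  have hright : ∫ θ in (π / 2)..π, F θ
      = Complex.exp (-Complex.I * (ν * (π / 2) : ℝ)) * schlafliHalf ν z := by
    have hshift := intervalIntegral.integral_comp_add_right (a := 0) (b := π / 2) F (π / 2)
    rw [zero_add, add_halves] at hshift
    rw [← hshift, schlafliHalf, ← intervalIntegral.integral_const_mul]
    refine intervalIntegral.integral_congr fun φ _ => ?_
    simp only [hF, ← Complex.exp_add, Real.sin_add_pi_div_two]
    congr 1
    push_cast
    ring
  have hleft : ∫ θ in (0 : ℝ)..(π / 2), F θ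
      = Complex.exp (-Complex.I * (ν * (π / 2) : ℝ)) * schlafliHalf (-ν) z := by
    have hreflect := intervalIntegral.integral_comp_sub_left (a := 0) (b := π / 2) F (π / 2)
    rw [sub_zero, sub_self] at hreflect
    rw [← hreflect, schlafliHalf, ← intervalIntegral.integral_const_mul]
    refine intervalIntegral.integral_congr fun φ _ => ?_
    simp only [hF, ← Complex.exp_add, Real.sin_pi_div_two_sub]
    congr 1
    push_cast
    ring
  rw [← intervalIntegral.integral_add_adjacent_intervals (b := π / 2)
    (hcont.intervalIntegrable _ _) (hcont.intervalIntegrable _ _), hleft, hright]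
  ring

theorem hankelH1_eq (ν z : ℝ) :
    hankelH1 ν z = (1 / π : ℝ) * (Complex.exp (-Complex.I * (ν * (π / 2) : ℝ))
        * (schlafliHalf ν z + schlafliHalf (-ν) z)) + hankelTail ν z := by
  have hre_im : ∫ θ in (0 : ℝ)..π, Complex.exp (Complex.I * (z * Real.sin θ - ν * θ : ℝ))
      = ((∫ θ in (0 : ℝ)..π, Real.cos (z * Real.sin θ - ν * θ) : ℝ) : ℂ)
        + Complex.I * ((∫ θ in (0 : ℝ)..π, Real.sin (z * Real.sin θ - ν * θ) : ℝ) : ℂ) := by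
    rw [← intervalIntegral.integral_ofReal, ← intervalIntegral.integral_ofReal,
      ← intervalIntegral.integral_const_mul, ← intervalIntegral.integral_add
        (Continuous.intervalIntegrable (by fun_prop) _ _)
        (Continuous.intervalIntegrable (by fun_prop) _ _)]
    refine intervalIntegral.integral_congr fun θ _ => ?_
    rw [mul_comm, Complex.exp_mul_I]
    push_cast
    ring
  rw [← integral_schlafli_eq, hre_im, hankelH1, besselJ, besselY, hankelTail]
  push_cast
  ring

theorem exists_sqrt_mul_norm_hankelH1_le {ν : ℝ} (hν : |ν| ≤ 1 / 2) :
    ∃ C : ℝ, ∀ z : ℝ, 0 < z → √z * ‖hankelH1 ν z‖ ≤ C := by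
  obtain ⟨C₁, hC₁⟩ := exists_norm_sqrt_mul_schlafliHalf_le ν
  obtain ⟨C₂, hC₂⟩ := exists_norm_sqrt_mul_schlafliHalf_le (-ν)
  refine ⟨1 / π * (C₁ + C₂) + 2 * √(π / 2), fun z hz => ?_⟩
  have htail : ‖hankelTail ν z‖ ≤ 2 * √(π / (2 * z)) :=
    (norm_hankelTail_le hν hz).trans (integral_exp_half_mul_exp_neg_mul_sinh_le_sqrt hz)
  have hosc : ‖((1 / π : ℝ) : ℂ) * (Complex.exp (-Complex.I * (ν * (π / 2) : ℝ))
      * (schlafliHalf ν z + schlafliHalf (-ν) z))‖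
      ≤ 1 / π * (‖schlafliHalf ν z‖ + ‖schlafliHalf (-ν) z‖) := by
    have hunit : ‖Complex.exp (-Complex.I * (ν * (π / 2) : ℝ))‖ = 1 := by simp [Complex.norm_exp]
    rw [norm_mul, norm_mul, hunit, one_mul, Complex.norm_real, Real.norm_of_nonneg (by positivity)]
    gcongr
    exact norm_add_le _ _
  have hsqrt : √(π / (2 * z)) * √z = √(π / 2) := by
    rw [← Real.sqrt_mul (by positivity)]
    congr 1
    field_simp
  calc √z * ‖hankelH1 ν z‖
      ≤ √z * (1 / π * (‖schlafliHalf ν z‖ + ‖schlafliHalf (-ν) z‖) + 2 * √(π / (2 * z))) := by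
        rw [hankelH1_eq]
        gcongr
        exact (norm_add_le _ _).trans (add_le_add hosc htail)
    _ = 1 / π * (√z * ‖schlafliHalf ν z‖ + √z * ‖schlafliHalf (-ν) z‖) + 2 * √(π / 2) := by
        rw [← hsqrt]
        ring
    _ ≤ 1 / π * (C₁ + C₂) + 2 * √(π / 2) := by
        gcongr
        exacts [hC₁ z hz.le, hC₂ z hz.le]

theorem tendsto_sqrt_mul_hankelTail {ν : ℝ} (hν : |ν| ≤ 1 / 2) :
    Tendsto (fun z : ℝ => (√z : ℂ) * Complex.exp (-Complex.I * z) * hankelTail ν z) atTop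
      (𝓝 0) := by
  have hlim : Tendsto (fun z : ℝ => 2 * (√z)⁻¹) atTop (𝓝 0) := by
    simpa using (Real.tendsto_sqrt_atTop.inv_tendsto_atTop).const_mul 2
  refine squeeze_zero_norm' ?_ hlim
  filter_upwards [eventually_ge_atTop 1] with z hz
  have hz0 : 0 < z := by linarith
  have htail := (norm_hankelTail_le hν hz0).trans (integral_exp_half_mul_exp_neg_mul_sinh_le_div hz)
  have hunit : ‖Complex.exp (-Complex.I * z)‖ = 1 := by simp [Complex.norm_exp]
  rw [norm_mul, norm_mul, hunit, mul_one, Complex.norm_real,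
    Real.norm_of_nonneg (Real.sqrt_nonneg z)]
  calc √z * ‖hankelTail ν z‖ ≤ √z * (2 / z) := by gcongr
    _ = 2 * (√z)⁻¹ := by rw [← Real.sqrt_div_self]; ring

theorem two_div_pi_mul_sqrt_two_mul_fresnelLim (ν : ℝ) :
    ((1 / π : ℝ) : ℂ) * (Complex.exp (-Complex.I * (ν * (π / 2) : ℝ))
        * (√2 * fresnelLim + √2 * fresnelLim))
      = √(2 / π) * Complex.exp (-Complex.I * (π * (2 * ν + 1) / 4 : ℝ)) := by
  have hphase : Complex.exp (-Complex.I * (π * (2 * ν + 1) / 4 : ℝ))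
      = Complex.exp (-Complex.I * (ν * (π / 2) : ℝ)) * Complex.exp (-(π / 4 : ℝ) * Complex.I) := by
    rw [← Complex.exp_add]
    congr 1
    push_cast
    ring
  have hmod : √(2 / π) = 1 / π * (√2 * √π) := by
    rw [Real.sqrt_div zero_le_two, div_eq_mul_inv, ← Real.sqrt_div_self]
    ring
  rw [hphase, hmod, fresnelLim]
  push_cast
  ring

theorem tendsto_sqrt_mul_hankelH1 {ν : ℝ} (hν : |ν| ≤ 1 / 2) :
    Tendsto (fun z : ℝ => (√z : ℂ) * Complex.exp (-Complex.I * z) * hankelH1 ν z) atTop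
      (𝓝 (√(2 / π) * Complex.exp (-Complex.I * (π * (2 * ν + 1) / 4 : ℝ)))) := by
  have hosc := ((tendsto_sqrt_mul_schlafliHalf ν).add
    (tendsto_sqrt_mul_schlafliHalf (-ν))).const_mul
      (Complex.exp (-Complex.I * (ν * (π / 2) : ℝ))) |>.const_mul ((1 / π : ℝ) : ℂ)
  have hsum := hosc.add (tendsto_sqrt_mul_hankelTail hν)
  rw [add_zero, two_div_pi_mul_sqrt_two_mul_fresnelLim] at hsum
  refine hsum.congr fun z => ?_
  rw [hankelH1_eq]
  ring

theorem measurable_setIntegral_of_continuous {F : ℝ → ℝ → ℝ} (hF : Continuous (Function.uncurry F))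
    (s : Set ℝ) : Measurable fun z => ∫ t in s, F z t :=
  (StronglyMeasurable.integral_prod_right (ν := volume.restrict s) hF.stronglyMeasurable).measurable

theorem measurable_besselJ (ν : ℝ) : Measurable (besselJ ν) := by
  unfold besselJ
  simp only [intervalIntegral.integral_of_le Real.pi_pos.le]
  exact ((measurable_setIntegral_of_continuous (by fun_prop) _).const_mul _).sub
    ((measurable_setIntegral_of_continuous (by fun_prop) _).const_mul _)

theorem measurable_besselY (ν : ℝ) : Measurable (besselY ν) := by
  unfold besselY
  simp only [intervalIntegral.integral_of_le Real.pi_pos.le]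
  exact ((measurable_setIntegral_of_continuous (by fun_prop) _).const_mul _).sub
    ((measurable_setIntegral_of_continuous (by fun_prop) _).const_mul _)

theorem measurable_hankelH1 (ν : ℝ) : Measurable (hankelH1 ν) :=
  (Complex.measurable_ofReal.comp (measurable_besselJ ν)).add
    ((Complex.measurable_ofReal.comp (measurable_besselY ν)).const_mul _)

/-! ### The outgoing kernel -/

theorem measurable_greenFn (n : ℕ) (k : ℝ) : Measurable (greenFn n k) := by
  unfold greenFn
  exact (measurable_const.mul (Complex.measurable_ofReal.comp (by fun_prop))).mul
    ((measurable_hankelH1 _).comp (by fun_prop))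

theorem abs_hankelOrder_le {n : ℕ} (hn : 1 ≤ n) (hn3 : n ≤ 3) : |((n : ℝ) - 2) / 2| ≤ 1 / 2 := by
  have h1 : (1 : ℝ) ≤ n := by exact_mod_cast hn
  have h3 : (n : ℝ) ≤ 3 := by exact_mod_cast hn3
  rw [abs_le]
  constructor <;> linarith

theorem rpow_mul_greenFn_eq (n : ℕ) {k r : ℝ} (hk : 0 < k) (hr : 0 < r) :
    ((r ^ (((n : ℝ) - 1) / 2) : ℝ) : ℂ) * greenFn n k r
      = Complex.I / 4 * (((k / (2 * π)) ^ (((n : ℝ) - 2) / 2) * k ^ (-(1 / 2) : ℝ) : ℝ) : ℂ)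
        * ((√(k * r) : ℂ) * hankelH1 (((n : ℝ) - 2) / 2) (k * r)) := by
  have hsplit : r ^ (((n : ℝ) - 1) / 2) = r ^ (((n : ℝ) - 2) / 2) * r ^ (1 / 2 : ℝ) := by
    rw [← Real.rpow_add hr]
    congr 1
    ring
  have hcancel : (k / (2 * π * r)) ^ (((n : ℝ) - 2) / 2) * r ^ (((n : ℝ) - 2) / 2)
      = (k / (2 * π)) ^ (((n : ℝ) - 2) / 2) := by
    rw [← Real.mul_rpow (by positivity) hr.le]
    congr 1
    field_simp
  have hsqrt : k ^ (-(1 / 2) : ℝ) * √(k * r) = r ^ (1 / 2 : ℝ) := by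
    rw [Real.sqrt_eq_rpow, Real.mul_rpow hk.le hr.le, ← mul_assoc, ← Real.rpow_add hk]
    simp
  rw [← hcancel, hsplit, greenFn, ← hsqrt]
  push_cast
  ring

theorem exists_rpow_mul_norm_greenFn_le {n : ℕ} (hn : 1 ≤ n) (hn3 : n ≤ 3) {k : ℝ} (hk : 0 < k) :
    ∃ C : ℝ, ∀ r : ℝ, 0 < r → r ^ (((n : ℝ) - 1) / 2) * ‖greenFn n k r‖ ≤ C := by
  obtain ⟨C, hC⟩ := exists_sqrt_mul_norm_hankelH1_le (abs_hankelOrder_le hn hn3)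
  refine ⟨‖Complex.I / 4
    * (((k / (2 * π)) ^ (((n : ℝ) - 2) / 2) * k ^ (-(1 / 2) : ℝ) : ℝ) : ℂ)‖ * C, fun r hr => ?_⟩
  have hnorm := congrArg norm (rpow_mul_greenFn_eq n hk hr)
  rw [norm_mul, Complex.norm_real, Real.norm_of_nonneg (by positivity), norm_mul (_ * _),
    norm_mul (√(k * r) : ℂ), Complex.norm_real, Real.norm_of_nonneg (Real.sqrt_nonneg _)] at hnorm
  rw [hnorm]
  gcongr
  exact hC _ (by positivity)

theorem greenFn_leadingCoeff_norm (ν : ℝ) {k : ℝ} (hk : 0 < k) :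
    (k / (2 * π)) ^ ν * k ^ (-(1 / 2) : ℝ) * √(2 / π) / 4
      = k ^ (ν - 1 / 2) / (2 * (2 * π) ^ (ν + 1 / 2)) := by
  have hnum : k ^ (ν - 1 / 2) = k ^ ν * k ^ (-(1 / 2) : ℝ) := by
    rw [← Real.rpow_add hk, sub_eq_add_neg]
  have hden : (2 * π) ^ (ν + 1 / 2) = (2 * π) ^ ν * √(2 * π) := by
    rw [Real.rpow_add (by positivity), ← Real.sqrt_eq_rpow]
  have hsqrt : √(2 / π) * √(2 * π) = 2 := by
    rw [← Real.sqrt_mul (by positivity), show 2 / π * (2 * π) = 2 ^ 2 by field_simp,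
      Real.sqrt_sq zero_le_two]
  rw [hnum, hden, Real.div_rpow hk.le (by positivity)]
  field_simp
  linarith

theorem greenFn_leadingCoeff_eq (n : ℕ) {k : ℝ} (hk : 0 < k) :
    Complex.I / 4 * (((k / (2 * π)) ^ (((n : ℝ) - 2) / 2) * k ^ (-(1 / 2) : ℝ) : ℝ) : ℂ)
        * (√(2 / π) * Complex.exp (-Complex.I * (π * (2 * (((n : ℝ) - 2) / 2) + 1) / 4 : ℝ)))
      = farFieldConst n * ((k ^ (((n : ℝ) - 3) / 2) : ℝ) : ℂ) := by
  have hphase : Complex.I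
        * Complex.exp (-Complex.I * (π * (2 * (((n : ℝ) - 2) / 2) + 1) / 4 : ℝ))
      = Complex.exp (-(Complex.I * (π : ℂ) * (((n : ℂ) - 3) / 4))) := by
    nth_rewrite 1 [← Complex.exp_pi_div_two_mul_I]
    rw [← Complex.exp_add]
    congr 1
    push_cast
    ring
  have hmod := greenFn_leadingCoeff_norm (((n : ℝ) - 2) / 2) hk
  rw [show ((n : ℝ) - 2) / 2 - 1 / 2 = ((n : ℝ) - 3) / 2 by ring,
    show ((n : ℝ) - 2) / 2 + 1 / 2 = ((n : ℝ) - 1) / 2 by ring] at hmod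
  have hmod' := congrArg (fun t : ℝ => (t : ℂ)) hmod
  rw [farFieldConst, ← hphase]
  push_cast at hmod' ⊢
  linear_combination
    Complex.I * Complex.exp (-Complex.I * (π * (2 * ((n - 2) / 2) + 1) / 4)) * hmod'

theorem tendsto_rpow_mul_greenFn {n : ℕ} (hn : 1 ≤ n) (hn3 : n ≤ 3) {k : ℝ} (hk : 0 < k) :
    Tendsto (fun r : ℝ => ((r ^ (((n : ℝ) - 1) / 2) : ℝ) : ℂ)
        * Complex.exp (-Complex.I * (k * r : ℝ)) * greenFn n k r) atTop
      (𝓝 (farFieldConst n * ((k ^ (((n : ℝ) - 3) / 2) : ℝ) : ℂ))) := by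
  have hlim := ((tendsto_sqrt_mul_hankelH1 (abs_hankelOrder_le hn hn3)).comp
    (tendsto_id.const_mul_atTop hk)).const_mul
      (Complex.I / 4 * (((k / (2 * π)) ^ (((n : ℝ) - 2) / 2) * k ^ (-(1 / 2) : ℝ) : ℝ) : ℂ))
  rw [greenFn_leadingCoeff_eq n hk] at hlim
  refine hlim.congr' ?_
  filter_upwards [eventually_gt_atTop 0] with r hr
  rw [mul_right_comm (((r ^ (((n : ℝ) - 1) / 2) : ℝ) : ℂ)), rpow_mul_greenFn_eq n hk hr]
  simp only [Function.comp_apply, id]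
  ring

/-! ### Mollification of locally square integrable functions -/

section MemLpLoc

variable {X F : Type*} [TopologicalSpace X] [MeasurableSpace X] [NormedAddCommGroup F]
  {p q : ℝ≥0∞} {μ : Measure X} {f : X → F}

/-- `f ∈ L^p_loc(μ)`, in the sense of `Admissible.V_mem`: `f` is `p`-integrable on every compact
set. -/
def MemLpLoc (f : X → F) (p : ℝ≥0∞) (μ : Measure X) : Prop :=
  ∀ K : Set X, IsCompact K → MemLp f p (μ.restrict K)

theorem MemLpLoc.mono_exponent [IsFiniteMeasureOnCompacts μ] (hf : MemLpLoc f q μ)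
    (hpq : p ≤ q) : MemLpLoc f p μ := fun K hK =>
  have : IsFiniteMeasure (μ.restrict K) := isFiniteMeasure_restrict.2 hK.measure_ne_top
  (hf K hK).mono_exponent hpq

theorem MemLpLoc.locallyIntegrable [WeaklyLocallyCompactSpace X] [IsFiniteMeasureOnCompacts μ]
    (hf : MemLpLoc f p μ) (hp : 1 ≤ p) : LocallyIntegrable f μ := fun x =>
  let ⟨K, hK, hxK⟩ := exists_compact_mem_nhds x
  ⟨K, hxK, memLp_one_iff_integrable.1 (hf.mono_exponent hp K hK)⟩

theorem MemLpLoc.locallyIntegrable_smul {𝕜 : Type*} [NormedField 𝕜] [NormedSpace 𝕜 F]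
    [WeaklyLocallyCompactSpace X] (hf : MemLpLoc f 2 μ) {h : X → 𝕜} (hh : MemLpLoc h 2 μ) :
    LocallyIntegrable (fun x => h x • f x) μ := fun x =>
  let ⟨K, hK, hxK⟩ := exists_compact_mem_nhds x
  ⟨K, hxK, memLp_one_iff_integrable.1 ((hf K hK).smul (hh K hK))⟩

theorem MemLpLoc.apply {ι 𝕜 : Type*} [Fintype ι] [RCLike 𝕜] {f : X → EuclideanSpace 𝕜 ι}
    (hf : MemLpLoc f p μ) (i : ι) : MemLpLoc (fun x => f x i) p μ := fun K hK =>
  memLp_piLp_iff.1 (hf K hK) i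

theorem MemLpLoc.memLp_smul [T2Space X] [OpensMeasurableSpace X] [NormedSpace ℝ F]
    [IsFiniteMeasureOnCompacts μ] (hf : MemLpLoc f p μ) {φ : X → ℝ} (hφ : Continuous φ)
    (hφc : HasCompactSupport φ) : MemLp (fun x => φ x • f x) p μ := by
  have hK : IsCompact (tsupport φ) := hφc
  have hind : (tsupport φ).indicator (fun x => φ x • f x) = fun x => φ x • f x :=
    indicator_eq_self.2 ((Function.support_smul_subset_left φ f).trans (subset_tsupport φ))
  rw [← hind, memLp_indicator_iff_restrict hK.measurableSet]
  exact (hf _ hK).smul (hφ.memLp_top_of_hasCompactSupport hφc _)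

end MemLpLoc

section Mollification

open scoped Convolution
open ContinuousLinearMap (lsmul)

variable {E F : Type*} [NormedAddCommGroup E] [NormedSpace ℝ E] [FiniteDimensional ℝ E]
  [MeasurableSpace E] [BorelSpace E] {μ : Measure E} [μ.IsAddHaarMeasure]
  [NormedAddCommGroup F] [NormedSpace ℝ F] {h : E → ℝ} {G : E → F}

theorem continuous_integral_translate_smul [CompleteSpace F] {p q : ℝ≥0∞} [Fact (1 ≤ p)]
    [Fact (1 ≤ q)] [Fact (p ≠ ⊤)] [p.HolderConjugate q] (hh : MemLp h p μ) (hG : MemLp G q μ) :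
    Continuous fun t : E => ∫ x, h (t + x) • G x ∂μ := by
  have hcont : Continuous fun t : E =>
      (lsmul ℝ ℝ : ℝ →L[ℝ] F →L[ℝ] F).lpPairing μ p q (DomAddAct.mk t +ᵥ hh.toLp h)
        (hG.toLp G) :=
    ((ContinuousLinearMap.lpPairing μ p q _).continuous.comp
      (DomAddAct.continuous_mk.vadd continuous_const)).clm_apply continuous_const
  refine hcont.congr fun t => ?_
  rw [ContinuousLinearMap.lpPairing_eq_integral, DomAddAct.mk_vadd_toLp]
  refine integral_congr_ae ?_
  filter_upwards [hG.coeFn_toLp, MemLp.coeFn_toLp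
    (hh.comp_measurePreserving (measurePreserving_vadd t μ))] with x hGx hhx
  rw [hGx, ContinuousLinearMap.lsmul_apply]
  exact congrArg (· • G x) hhx

theorem integrable_mollify_integrand {ρ : E → ℝ} (hρ : Integrable ρ μ) (hh : MemLp h 2 μ)
    (hG : MemLp G 2 μ) :
    Integrable (Function.uncurry fun x t => (ρ t * h (x - t)) • G x) (μ.prod μ) := by
  have hmeas : AEStronglyMeasurable (Function.uncurry fun x t => (ρ t * h (x - t)) • G x)
      (μ.prod μ) :=
    (hρ.aestronglyMeasurable.convolution_integrand (lsmul ℝ ℝ) hh.1).smul hG.1.comp_fst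
  have hG2 : Integrable (fun z : E × E => ‖G z.1‖ ^ 2 * ‖ρ z.2‖) (μ.prod μ) :=
    hG.norm.integrable_sq.mul_prod hρ.norm
  have hh2 : Integrable (fun z : E × E => ‖ρ z.2‖ * h (z.1 - z.2) ^ 2) (μ.prod μ) :=
    hρ.norm.convolution_integrand (lsmul ℝ ℝ) hh.integrable_sq
  refine (hG2.add hh2).mono' hmeas (Eventually.of_forall fun ⟨x, t⟩ => ?_)
  have hamgm : |h (x - t)| * ‖G x‖ ≤ ‖G x‖ ^ 2 + h (x - t) ^ 2 := by
    nlinarith [sq_nonneg (|h (x - t)| - ‖G x‖), sq_abs (h (x - t)), sq_nonneg (h (x - t)),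
      sq_nonneg ‖G x‖]
  calc ‖(ρ t * h (x - t)) • G x‖ = ‖ρ t‖ * (|h (x - t)| * ‖G x‖) := by
        rw [norm_smul, norm_mul, Real.norm_eq_abs (h _), mul_assoc]
    _ ≤ ‖ρ t‖ * (‖G x‖ ^ 2 + h (x - t) ^ 2) := by gcongr
    _ = ‖G x‖ ^ 2 * ‖ρ t‖ + ‖ρ t‖ * h (x - t) ^ 2 := by ring

theorem integral_convolution_smul [CompleteSpace F] {ρ : E → ℝ} (hρ : Integrable ρ μ)
    (hh : MemLp h 2 μ) (hG : MemLp G 2 μ) :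
    ∫ x, (ρ ⋆[lsmul ℝ ℝ, μ] h) x • G x ∂μ
      = (ρ ⋆[lsmul ℝ ℝ, μ] fun t => ∫ x, h (t + x) • G x ∂μ) 0 := by
  simp only [convolution_def, ContinuousLinearMap.lsmul_apply, ← integral_smul_const,
    ← integral_smul, smul_eq_mul, smul_smul, zero_sub, neg_add_eq_sub]
  exact integral_integral_swap (integrable_mollify_integrand hρ hh hG)

theorem tendsto_integral_mollify_smul_of_memLp [CompleteSpace F] (hh : MemLp h 2 μ)
    (hG : MemLp G 2 μ) {b : ℕ → ContDiffBump (0 : E)}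
    (hb : Tendsto (fun m => (b m).rOut) atTop (𝓝 0)) :
    Tendsto (fun m => ∫ x, ((b m).normed μ ⋆[lsmul ℝ ℝ, μ] h) x • G x ∂μ) atTop
      (𝓝 (∫ x, h x • G x ∂μ)) := by
  have : Fact ((2 : ℝ≥0∞) ≠ ⊤) := ⟨by norm_num⟩
  have hlim := ContDiffBump.convolution_tendsto_right_of_continuous (μ := μ) hb
    (continuous_integral_translate_smul hh hG) 0
  simp only [zero_add] at hlim
  simpa only [integral_convolution_smul (b _).integrable_normed hh hG] using hlim

theorem tendsto_integral_mollify_smul [CompleteSpace F] (hh : MemLpLoc h 2 μ)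
    (hG : MemLp G 2 μ) (hGc : HasCompactSupport G) {b : ℕ → ContDiffBump (0 : E)}
    (hb : Tendsto (fun m => (b m).rOut) atTop (𝓝 0)) :
    Tendsto (fun m => ∫ x, ((b m).normed μ ⋆[lsmul ℝ ℝ, μ] h) x • G x ∂μ) atTop
      (𝓝 (∫ x, h x • G x ∂μ)) := by
  set K := Metric.cthickening 1 (tsupport G)
  have hK : IsCompact K := hGc.isCompact.cthickening
  have hlim := tendsto_integral_mollify_smul_of_memLp
    ((memLp_indicator_iff_restrict hK.measurableSet).2 (hh K hK)) hG hb
  have hsmul : ∀ {u v : E → ℝ}, (∀ x ∈ tsupport G, u x = v x) →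
      ∫ x, u x • G x ∂μ = ∫ x, v x • G x ∂μ := fun huv => integral_congr_ae <|
    Eventually.of_forall fun x => by
      by_cases hx : x ∈ tsupport G
      · simp only [huv x hx]
      · simp only [image_eq_zero_of_notMem_tsupport hx, smul_zero]
  rw [hsmul fun x hx => indicator_of_mem (Metric.self_subset_cthickening _ hx) h] at hlim
  refine hlim.congr' ?_
  filter_upwards [hb.eventually (gt_mem_nhds zero_lt_one)] with m hm
  refine hsmul fun x hx => integral_congr_ae <| Eventually.of_forall fun t => ?_
  by_cases ht : t ∈ Metric.ball (0 : E) (b m).rOut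
  · have hxt : x - t ∈ K := Metric.mem_cthickening_of_dist_le _ x _ _ hx <| by
      rw [dist_eq_norm, sub_sub_cancel_left, norm_neg]
      exact (mem_ball_zero_iff.1 ht).le.trans hm.le
    simp only [indicator_of_mem hxt]
  · rw [← (b m).support_normed_eq (μ := μ), Function.notMem_support] at ht
    simp [ht]

end Mollification

/-! ### Weak derivatives -/

section WeakDerivatives

open scoped Convolution
open ContinuousLinearMap (lsmul)

theorem locallyIntegrable_piLp_iff {X ι 𝕜 : Type*} [Fintype ι] [RCLike 𝕜] [TopologicalSpace X]
    [LocallyCompactSpace X] [MeasurableSpace X] {μ : Measure X} {f : X → EuclideanSpace 𝕜 ι} :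
    LocallyIntegrable f μ ↔ ∀ i, LocallyIntegrable (fun x => f x i) μ := by
  simp only [locallyIntegrable_iff, IntegrableOn, integrable_piLp_iff]
  exact ⟨fun h i K hK => h K hK i, fun h K hK i => h i K hK⟩

variable {n : ℕ} {φ : Rn n → ℝ}

theorem pderiv_mul {ψ : Rn n → ℝ} {x : Rn n} (hφ : DifferentiableAt ℝ φ x)
    (hψ : DifferentiableAt ℝ ψ x) (i : Fin n) :
    pderiv i (fun y => φ y * ψ y) x = pderiv i φ x * ψ x + φ x * pderiv i ψ x := by
  simp only [pderiv, fderiv_fun_mul hφ hψ, add_apply, smul_apply, smul_eq_mul]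
  ring

theorem continuous_pderiv (hφ : ContDiff ℝ ∞ φ) (i : Fin n) : Continuous (pderiv i φ) :=
  (hφ.continuous_fderiv (by simp)).clm_apply continuous_const

theorem IsTestFn.hasCompactSupport_pderiv (hφ : IsTestFn φ) (i : Fin n) :
    HasCompactSupport (pderiv i φ) :=
  hφ.2.fderiv_apply (𝕜 := ℝ) _

theorem IsTestFn.mul_right (hφ : IsTestFn φ) {w : Rn n → ℝ} (hw : ContDiff ℝ ∞ w) :
    IsTestFn fun x => φ x * w x :=
  ⟨hφ.1.mul hw, hφ.2.mul_right⟩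

theorem IsTestFn.comp_sub_left (hφ : IsTestFn φ) (x : Rn n) : IsTestFn fun s => φ (x - s) :=
  ⟨hφ.1.comp (contDiff_const.sub contDiff_id), hφ.2.comp_homeomorph (Homeomorph.subLeft x)⟩

theorem pderiv_comp_sub_left (hφ : Differentiable ℝ φ) (i : Fin n) (x s : Rn n) :
    pderiv i (fun s => φ (x - s)) s = -pderiv i φ (x - s) := by
  have h := (hφ (x - s)).hasFDerivAt.comp s ((hasFDerivAt_id s).const_sub x)
  rw [pderiv, show fderiv ℝ (fun s => φ (x - s)) s = _ from h.fderiv]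
  simp [pderiv]

theorem IsTestFn.integrable_smul {F : Type*} [NormedAddCommGroup F] [NormedSpace ℝ F]
    (hφ : IsTestFn φ) {f : Rn n → F} (hf : LocallyIntegrable f volume) :
    Integrable fun x => φ x • f x :=
  hf.integrable_smul_left_of_hasCompactSupport hφ.1.continuous hφ.2

theorem IsTestFn.integrable_pderiv_smul {F : Type*} [NormedAddCommGroup F] [NormedSpace ℝ F]
    (hφ : IsTestFn φ) (i : Fin n) {f : Rn n → F} (hf : LocallyIntegrable f volume) :
    Integrable fun x => pderiv i φ x • f x :=
  hf.integrable_smul_left_of_hasCompactSupport (continuous_pderiv hφ.1 i)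
    (hφ.hasCompactSupport_pderiv i)

theorem IsTestFn.pderiv_convolution (hφ : IsTestFn φ) {w : Rn n → ℝ}
    (hw : LocallyIntegrable w volume) (i : Fin n) (x : Rn n) :
    pderiv i (φ ⋆[lsmul ℝ ℝ, volume] w) x = ∫ s, pderiv i φ (x - s) * w s := by
  have hφ1 : ContDiff ℝ 1 φ := hφ.1.of_le (by exact_mod_cast le_top)
  have hexists := (hφ.2.fderiv (𝕜 := ℝ)).convolutionExists_left ((lsmul ℝ ℝ).precompL (Rn n))
    (hφ1.continuous_fderiv one_ne_zero) hw x
  rw [pderiv, (hφ.2.hasFDerivAt_convolution_left (lsmul ℝ ℝ) hφ1 hw x).fderiv, convolution_def,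
    ContinuousLinearMap.integral_apply hexists,
    ← integral_sub_left_eq_self _ volume x]
  simp only [ContinuousLinearMap.precompL_apply, ContinuousLinearMap.lsmul_apply, smul_eq_mul,
    sub_sub_cancel, pderiv]

theorem IsWeakDiv.sum_pderiv_convolution {W : Rn n → Rn n} {d : Rn n → ℝ}
    (h : IsWeakDiv (𝕜 := ℝ) W d) (hφ : IsTestFn φ) (x : Rn n) :
    ∑ i, pderiv i (φ ⋆[lsmul ℝ ℝ, volume] fun s => W s i) x
      = (φ ⋆[lsmul ℝ ℝ, volume] d) x := by
  have hW := locallyIntegrable_piLp_iff.1 h.1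
  have hint : ∀ i, Integrable fun s => pderiv i φ (x - s) * W s i := fun i => by
    simpa only [pderiv_comp_sub_left (hφ.1.differentiable (by simp)), smul_eq_mul, neg_mul,
      integrable_fun_neg_iff] using (hφ.comp_sub_left x).integrable_pderiv_smul i (hW i)
  have hdiv := h.2.2 _ (hφ.comp_sub_left x)
  simp only [pderiv_comp_sub_left (hφ.1.differentiable (by simp)), smul_eq_mul, neg_mul,
    Finset.sum_neg_distrib, integral_neg, neg_inj] at hdiv
  rw [convolution_lsmul_swap, Finset.sum_congr rfl fun i _ => hφ.pderiv_convolution (hW i) i x,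
    ← integral_finsetSum _ fun i _ => hint i]
  exact hdiv

theorem integrable_smul_smul_of_hasCompactSupport {X F : Type*} [TopologicalSpace X] [T2Space X]
    [MeasurableSpace X] [OpensMeasurableSpace X] [NormedAddCommGroup F] [NormedSpace ℝ F]
    {μ : Measure X} {f : X → F} (hf : LocallyIntegrable f μ) {w φ : X → ℝ} (hw : Continuous w)
    (hφ : Continuous φ) (hφc : HasCompactSupport φ) :
    Integrable (fun x => w x • φ x • f x) μ := by
  simp only [smul_smul]
  exact hf.integrable_smul_left_of_hasCompactSupport (hw.mul hφ) hφc.mul_left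

theorem IsWeakGrad.integral_smooth_smul {f : Rn n → ℂ} {g : Rn n → Vec ℂ n}
    (h : IsWeakGrad f g) (hφ : IsTestFn φ) {w : Rn n → ℝ} (hw : ContDiff ℝ ∞ w) (i : Fin n) :
    (∫ x, w x • pderiv i φ x • f x) + (∫ x, w x • φ x • g x i)
      + ∫ x, pderiv i w x • φ x • f x = 0 := by
  have hleib : ∀ x, pderiv i (fun y => φ y * w y) x • f x
      = w x • pderiv i φ x • f x + pderiv i w x • φ x • f x := fun x => by
    rw [pderiv_mul (hφ.1.differentiable (by simp) x) (hw.differentiable (by simp) x), add_smul,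
      smul_smul, smul_smul, mul_comm (w x), mul_comm (φ x)]
  have hparts := h.2.2 _ (hφ.mul_right hw) i
  simp only [hleib] at hparts
  simp only [mul_comm (φ _), mul_smul] at hparts
  rw [integral_add
    (integrable_smul_smul_of_hasCompactSupport h.1 hw.continuous (continuous_pderiv hφ.1 i)
      (hφ.hasCompactSupport_pderiv i))
    (integrable_smul_smul_of_hasCompactSupport h.1 (continuous_pderiv hw i) hφ.1.continuous hφ.2)]
    at hparts
  rw [add_right_comm, hparts, neg_add_cancel]

section ProductRule

variable {W : Rn n → Rn n} {d : Rn n → ℝ} {f : Rn n → ℂ} {g : Rn n → Vec ℂ n}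

theorem IsWeakDiv.integral_mollified_product_rule (hdiv : IsWeakDiv (𝕜 := ℝ) W d)
    (hfg : IsWeakGrad f g) {ρ : Rn n → ℝ} (hρ : IsTestFn ρ) (hφ : IsTestFn φ) :
    ∑ i, ((∫ x, (ρ ⋆[lsmul ℝ ℝ, volume] fun s => W s i) x • pderiv i φ x • f x)
        + ∫ x, (ρ ⋆[lsmul ℝ ℝ, volume] fun s => W s i) x • φ x • g x i)
      + ∫ x, (ρ ⋆[lsmul ℝ ℝ, volume] d) x • φ x • f x = 0 := by
  have hsmooth : ∀ i, ContDiff ℝ ∞ (ρ ⋆[lsmul ℝ ℝ, volume] fun s => W s i) := fun i =>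
    hρ.2.contDiff_convolution_left (lsmul ℝ ℝ) hρ.1 (locallyIntegrable_piLp_iff.1 hdiv.1 i)
  simp only [← hdiv.sum_pderiv_convolution hρ, Finset.sum_smul]
  rw [integral_finsetSum _ fun i _ => integrable_smul_smul_of_hasCompactSupport hfg.1
    (continuous_pderiv (hsmooth i) i) hφ.1.continuous hφ.2, ← Finset.sum_add_distrib]
  exact Finset.sum_eq_zero fun i _ => hfg.integral_smooth_smul hφ (hsmooth i) i

theorem IsWeakDiv.integral_product_rule (hdiv : IsWeakDiv (𝕜 := ℝ) W d) (hfg : IsWeakGrad f g)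
    (hW : MemLpLoc W 2 volume) (hd : MemLpLoc d 2 volume) (hf : MemLpLoc f 2 volume)
    (hg : MemLpLoc g 2 volume) (hφ : IsTestFn φ) :
    ∑ i, ((∫ x, W x i • pderiv i φ x • f x) + ∫ x, W x i • φ x • g x i)
      + ∫ x, d x • φ x • f x = 0 := by
  let b : ℕ → ContDiffBump (0 : Rn n) := fun m =>
    ⟨1 / ((m : ℝ) + 1) / 2, 1 / ((m : ℝ) + 1), by positivity, half_lt_self (by positivity)⟩
  have hb : Tendsto (fun m => (b m).rOut) atTop (𝓝 0) := tendsto_one_div_add_atTop_nhds_zero_nat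
  have hρ : ∀ m, IsTestFn ((b m).normed volume) := fun m =>
    ⟨(b m).contDiff_normed, (b m).hasCompactSupport_normed⟩
  have hlim := (tendsto_finsetSum Finset.univ fun i _ =>
    (tendsto_integral_mollify_smul (hW.apply i)
      (hf.memLp_smul (continuous_pderiv hφ.1 i) (hφ.hasCompactSupport_pderiv i))
      (hφ.hasCompactSupport_pderiv i).smul_right hb).add
    (tendsto_integral_mollify_smul (hW.apply i) ((hg.apply i).memLp_smul hφ.1.continuous hφ.2)
      hφ.2.smul_right hb)).add
    (tendsto_integral_mollify_smul hd (hf.memLp_smul hφ.1.continuous hφ.2) hφ.2.smul_right hb)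
  simp only [hdiv.integral_mollified_product_rule hfg (hρ _) hφ] at hlim
  exact tendsto_nhds_unique tendsto_const_nhds hlim |>.symm

theorem locallyIntegrable_mulField (hW : MemLpLoc W 2 volume) (hf : MemLpLoc f 2 volume) :
    LocallyIntegrable (mulField W f) volume :=
  locallyIntegrable_piLp_iff.2 fun i => by
    simpa only [mulField, Complex.real_smul] using hf.locallyIntegrable_smul (hW.apply i)

theorem isWeakDiv_mulField (hdiv : IsWeakDiv (𝕜 := ℝ) W d) (hfg : IsWeakGrad f g)
    (hW : MemLpLoc W 2 volume) (hd : MemLpLoc d 2 volume) (hf : MemLpLoc f 2 volume)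
    (hg : MemLpLoc g 2 volume) :
    IsWeakDiv (mulField W f) fun x => (d x : ℂ) * f x + ∑ i, (W x i : ℂ) * g x i := by
  simp only [← Complex.real_smul]
  have hWf : ∀ i, LocallyIntegrable (fun x => W x i • f x) volume := fun i =>
    hf.locallyIntegrable_smul (hW.apply i)
  have hWg : ∀ i, LocallyIntegrable (fun x => W x i • g x i) volume := fun i =>
    (hg.apply i).locallyIntegrable_smul (hW.apply i)
  have hdf := hf.locallyIntegrable_smul hd
  have hsum := locallyIntegrable_finsetSum Finset.univ fun i _ => hWg i
  refine ⟨locallyIntegrable_mulField hW hf, hdf.add hsum, fun φ hφ => ?_⟩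
  have h := hdiv.integral_product_rule hfg hW hd hf hg hφ
  simp only [smul_comm (W _ _), smul_comm (d _)] at h
  rw [Finset.sum_add_distrib, add_assoc] at h
  simp only [smul_add, Finset.smul_sum]
  rw [integral_add (hφ.integrable_smul hdf)
      (integrable_finsetSum _ fun i _ => hφ.integrable_smul (hWg i)),
    integral_finsetSum _ fun i _ => hφ.integrable_smul (hWg i), add_comm (∫ x, _),
    ← eq_neg_of_add_eq_zero_left h,
    ← integral_finsetSum _ fun i _ => hφ.integrable_pderiv_smul i (hWf i)]
  simp only [mulField, Complex.real_smul]

end ProductRule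

theorem IsWeakDiv.ae_eq {𝕜 : Type} [RCLike 𝕜] {F : Rn n → Vec 𝕜 n} {d₁ d₂ : Rn n → 𝕜}
    (h₁ : IsWeakDiv F d₁) (h₂ : IsWeakDiv F d₂) : d₁ =ᵐ[volume] d₂ :=
  ae_eq_of_integral_contDiff_smul_eq h₁.2.1 h₂.2.1 fun φ hφ hc =>
    neg_injective ((h₁.2.2 φ ⟨hφ, hc⟩).symm.trans (h₂.2.2 φ ⟨hφ, hc⟩))

theorem IsWeakGrad.ae_eq {f : Rn n → ℂ} {g₁ g₂ : Rn n → Vec ℂ n} (h₁ : IsWeakGrad f g₁)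
    (h₂ : IsWeakGrad f g₂) : g₁ =ᵐ[volume] g₂ := by
  have hcoord : ∀ i, ∀ᵐ x, g₁ x i = g₂ x i := fun i =>
    ae_eq_of_integral_contDiff_smul_eq (locallyIntegrable_piLp_iff.1 h₁.2.1 i)
      (locallyIntegrable_piLp_iff.1 h₂.2.1 i) fun φ hφ hc =>
        neg_injective ((h₁.2.2 φ ⟨hφ, hc⟩ i).symm.trans (h₂.2.2 φ ⟨hφ, hc⟩ i))
  filter_upwards [ae_all_iff.2 hcoord] with x hx
  exact PiLp.ext hx

theorem IsWeakDiv.weakDiv_ae_eq {F : Rn n → Vec ℂ n} {d : Rn n → ℂ} (h : IsWeakDiv F d) :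
    weakDiv F =ᵐ[volume] d := by
  have hex : ∃ d, IsWeakDiv F d := ⟨d, h⟩
  rw [weakDiv, dif_pos hex]
  exact hex.choose_spec.ae_eq h

theorem IsWeakGrad.weakGrad_ae_eq {f : Rn n → ℂ} {g : Rn n → Vec ℂ n} (h : IsWeakGrad f g) :
    weakGrad f =ᵐ[volume] g := by
  have hex : ∃ g, IsWeakGrad f g := ⟨g, h⟩
  rw [weakGrad, dif_pos hex]
  exact hex.choose_spec.ae_eq h

end WeakDerivatives

/-! ### Weighted spaces -/

section Weights

variable {n : ℕ} {F : Type} [NormedAddCommGroup F] [NormedSpace ℝ F] {p : ℝ≥0∞} {σ τ : ℝ}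

/-- The weight `(1 + |x|²)^{σ/2}` of the spaces `L^p_σ(ℝⁿ)`. -/
noncomputable def weight (σ : ℝ) (x : Rn n) : ℝ := (1 + ‖x‖ ^ 2) ^ (σ / 2)

/-- `f ∈ L^p_σ` near infinity, i.e. outside some ball. -/
def MemWeightedLpAtInfty (p : ℝ≥0∞) (σ : ℝ) (f : Rn n → F) : Prop :=
  ∃ R, MemLp (fun x => weight σ x • f x) p (volume.restrict (Metric.closedBall 0 R)ᶜ)

theorem weight_pos (σ : ℝ) (x : Rn n) : 0 < weight σ x := by
  unfold weight; positivity

theorem weight_add (σ τ : ℝ) (x : Rn n) : weight (σ + τ) x = weight σ x * weight τ x := by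
  rw [weight, add_div, Real.rpow_add (by positivity)]
  rfl

theorem weight_neg_smul_weight_smul (σ : ℝ) (x : Rn n) (v : F) :
    weight (-σ) x • weight σ x • v = v := by
  rw [smul_smul, ← weight_add, neg_add_cancel]
  simp [weight]

theorem continuous_weight (σ : ℝ) : Continuous (weight σ : Rn n → ℝ) :=
  Continuous.rpow_const (by fun_prop) fun x => Or.inl (by positivity)

theorem norm_rpow_le_weight (hσ : 0 ≤ σ) (x : Rn n) : ‖x‖ ^ σ ≤ weight σ x := by
  rw [show ‖x‖ ^ σ = (‖x‖ ^ 2) ^ (σ / 2) by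
    rw [← Real.rpow_natCast_mul (norm_nonneg x)]; congr 1; push_cast; ring]
  exact Real.rpow_le_rpow (by positivity) (by linarith) (by positivity)

theorem weight_le_two_rpow_mul_norm_rpow (hσ : 0 ≤ σ) {x : Rn n} (hx : 1 ≤ ‖x‖) :
    weight σ x ≤ 2 ^ (σ / 2) * ‖x‖ ^ σ := by
  rw [show ‖x‖ ^ σ = (‖x‖ ^ 2) ^ (σ / 2) by
    rw [← Real.rpow_natCast_mul (norm_nonneg x)]; congr 1; push_cast; ring,
    ← Real.mul_rpow (by norm_num) (by positivity)]
  exact Real.rpow_le_rpow (by positivity) (by nlinarith) (by positivity)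

theorem MemWeightedLp.memLpLoc {f : Rn n → F} (hf : MemWeightedLp p σ f) :
    MemLpLoc f p volume := fun K hK => by
  obtain ⟨C, hC⟩ := hK.exists_bound_of_continuousOn (continuous_weight (-σ)).continuousOn
  have hw : MemLp (weight (-σ)) ⊤ (volume.restrict K) :=
    memLp_top_of_bound (continuous_weight _).aestronglyMeasurable C
      ((ae_restrict_iff' hK.measurableSet).2 (Eventually.of_forall hC))
  exact (memLp_congr_ae (Eventually.of_forall fun x =>
    weight_neg_smul_weight_smul σ x (f x))).1 ((hf.restrict K).smul hw)

theorem memLp_weight_neg (hσ : (n : ℝ) / 2 < σ) : MemLp (weight (-σ) : Rn n → ℝ) 2 volume := by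
  rw [memLp_two_iff_integrable_sq (continuous_weight _).aestronglyMeasurable]
  have h := integrable_rpow_neg_one_add_norm_sq (E := Rn n) (μ := volume) (r := 2 * σ)
    (by rw [finrank_euclideanSpace_fin]; linarith)
  refine h.congr (Eventually.of_forall fun x => ?_)
  change (1 + ‖x‖ ^ 2) ^ (-(2 * σ) / 2) = weight (-σ) x ^ 2
  rw [sq (weight _ _), ← weight_add, weight]
  ring_nf

theorem integrable_of_memWeightedLpAtInfty {f : Rn n → F}
    (hf : LocallyIntegrable f) (hσ : (n : ℝ) / 2 < σ) (hinf : MemWeightedLpAtInfty 2 σ f) :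
    Integrable f := by
  obtain ⟨R, hR⟩ := hinf
  rw [← integrableOn_univ, ← union_compl_self (Metric.closedBall (0 : Rn n) R)]
  refine (hf.integrableOn_isCompact (isCompact_closedBall 0 R)).union ?_
  refine (memLp_one_iff_integrable.1 (hR.smul ((memLp_weight_neg hσ).restrict _))).congr ?_
  exact Eventually.of_forall fun x => weight_neg_smul_weight_smul σ x (f x)

end Weights

section Decay

variable {n : ℕ} {F : Type} [NormedAddCommGroup F] {μ ν : ℝ}

theorem DecaysLike.norm {g : Rn n → F} (hg : DecaysLike μ g) : DecaysLike μ fun x => ‖g x‖ := by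
  simpa only [DecaysLike, norm_norm] using hg

theorem DecaysLike.add {g h : Rn n → F} (hg : DecaysLike μ g) (hh : DecaysLike μ h) :
    DecaysLike μ fun x => g x + h x := by
  obtain ⟨c₁, R₁, h₁⟩ := hg
  obtain ⟨c₂, R₂, h₂⟩ := hh
  refine ⟨c₁ + c₂, max R₁ R₂, ?_⟩
  filter_upwards [h₁, h₂] with x hx₁ hx₂ hx
  rw [add_div]
  exact (norm_add_le _ _).trans
    (add_le_add (hx₁ ((le_max_left _ _).trans hx)) (hx₂ ((le_max_right _ _).trans hx)))

theorem DecaysLike.mul {g h : Rn n → ℝ} (hg : DecaysLike μ g) (hh : DecaysLike ν h) :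
    DecaysLike (μ + ν) fun x => g x * h x := by
  obtain ⟨c₁, R₁, h₁⟩ := hg
  obtain ⟨c₂, R₂, h₂⟩ := hh
  refine ⟨c₁ * c₂, max 1 (max R₁ R₂), ?_⟩
  filter_upwards [h₁, h₂] with x hx₁ hx₂ hx
  obtain ⟨hx1, hR₁, hR₂⟩ := by simpa only [max_le_iff] using hx
  have hb₁ := hx₁ hR₁
  rw [norm_mul, Real.rpow_add (by linarith), mul_div_mul_comm]
  exact mul_le_mul hb₁ (hx₂ hR₂) (norm_nonneg _) ((norm_nonneg _).trans hb₁)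

theorem DecaysLike.mono {g : Rn n → F} (hg : DecaysLike ν g) (h : μ ≤ ν) : DecaysLike μ g := by
  obtain ⟨c, R, hc⟩ := hg
  refine ⟨|c|, max 1 R, ?_⟩
  filter_upwards [hc] with x hx hR
  have hx1 : 1 ≤ ‖x‖ := (le_max_left _ _).trans hR
  calc ‖g x‖ ≤ c / ‖x‖ ^ ν := hx ((le_max_right _ _).trans hR)
    _ ≤ |c| / ‖x‖ ^ μ :=
      div_le_div₀ (abs_nonneg c) (le_abs_self c) (by positivity)
        (Real.rpow_le_rpow_of_exponent_le hx1 h)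

theorem DecaysLike.exists_norm_weight_mul_le {g : Rn n → ℝ} (hg : DecaysLike μ g) (hμ : 0 ≤ μ) :
    ∃ C R, ∀ᵐ x : Rn n, R ≤ ‖x‖ → ‖weight μ x * g x‖ ≤ C := by
  obtain ⟨c, R, hc⟩ := hg
  refine ⟨2 ^ (μ / 2) * c, max 1 R, ?_⟩
  filter_upwards [hc] with x hx hR
  have hx1 : 1 ≤ ‖x‖ := (le_max_left _ _).trans hR
  have : 0 < ‖x‖ ^ μ := by positivity
  calc ‖weight μ x * g x‖ = weight μ x * ‖g x‖ := by
        rw [norm_mul, Real.norm_of_nonneg (weight_pos μ x).le]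
    _ ≤ 2 ^ (μ / 2) * ‖x‖ ^ μ * (c / ‖x‖ ^ μ) :=
      mul_le_mul (weight_le_two_rpow_mul_norm_rpow hμ hx1) (hx ((le_max_right _ _).trans hR))
        (norm_nonneg _) (by positivity)
    _ = 2 ^ (μ / 2) * c := by field_simp

end Decay

/-! ### The source term -/

section Source

variable {n : ℕ} {W : Rn n → Rn n} {V d : Rn n → ℝ} {f : Rn n → ℂ} {g : Rn n → Vec ℂ n}

theorem norm_sum_ofReal_mul_le (w : Rn n) (z : Vec ℂ n) :
    ‖∑ i, (w i : ℂ) * z i‖ ≤ ‖w‖ * ‖z‖ := by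
  have h := norm_inner_le_norm (𝕜 := ℂ) (WithLp.toLp 2 fun i => (w i : ℂ)) z
  have hw : ‖(WithLp.toLp 2 fun i => (w i : ℂ) : Vec ℂ n)‖ = ‖w‖ := by
    simp [EuclideanSpace.norm_eq]
  rw [hw] at h
  simpa [PiLp.inner_apply, mul_comm] using h

theorem source_ae_eq (hD : IsWeakDiv (mulField W f) fun x => d x * f x + ∑ i, W x i * g x i)
    (hfg : IsWeakGrad f g) :
    source W V f =ᵐ[volume] fun y => (Complex.I * d y - (‖W y‖ ^ 2 + V y : ℝ)) * f y
      + 2 * Complex.I * ∑ i, W y i * g y i := by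
  filter_upwards [hD.weakDiv_ae_eq, hfg.weakGrad_ae_eq] with y hdiv hgrad
  rw [source, hdiv, hgrad]
  ring

/-- The size of the coefficients of the first order operator `f ↦ source W V f`, where `d = ∇·W`. -/
noncomputable def coeffSize (W : Rn n → Rn n) (V d : Rn n → ℝ) (y : Rn n) : ℝ :=
  ‖d y‖ + 2 * ‖W y‖ + ‖W y‖ ^ 2 + ‖V y‖

theorem norm_source_le
    (hD : IsWeakDiv (mulField W f) fun x => d x * f x + ∑ i, W x i * g x i)
    (hfg : IsWeakGrad f g) :
    ∀ᵐ y, ‖source W V f y‖ ≤ coeffSize W V d y * (‖f y‖ + ‖g y‖) := by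
  filter_upwards [source_ae_eq (V := V) hD hfg] with y hy
  have hzeroth : ‖Complex.I * d y - (‖W y‖ ^ 2 + V y : ℝ)‖ ≤ ‖d y‖ + (‖W y‖ ^ 2 + ‖V y‖) := by
    refine (norm_sub_le _ _).trans (add_le_add (by simp) ?_)
    rw [Complex.norm_real]
    exact (norm_add_le _ _).trans (by simp)
  have hfirst : ‖2 * Complex.I * ∑ i, (W y i : ℂ) * g y i‖ ≤ 2 * ‖W y‖ * ‖g y‖ := by
    rw [norm_mul, mul_assoc]
    simpa using norm_sum_ofReal_mul_le (W y) (g y)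
  calc ‖source W V f y‖ ≤ (‖d y‖ + (‖W y‖ ^ 2 + ‖V y‖)) * ‖f y‖ + 2 * ‖W y‖ * ‖g y‖ := by
        rw [hy]
        refine (norm_add_le _ _).trans (add_le_add ?_ hfirst)
        rw [norm_mul]
        gcongr
    _ ≤ coeffSize W V d y * (‖f y‖ + ‖g y‖) := by
        have : 0 ≤ 2 * ‖W y‖ * ‖f y‖ + (‖d y‖ + ‖W y‖ ^ 2 + ‖V y‖) * ‖g y‖ := by positivity
        rw [coeffSize]
        linarith

theorem memLpLoc_coeffSize (hW : MemLpLoc W ⊤ volume) (hV : MemLpLoc V 2 volume)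
    (hd : MemLpLoc d 2 volume) : MemLpLoc (coeffSize W V d) 2 volume := fun K hK => by
  have hW2 : MemLp W 2 (volume.restrict K) := hW.mono_exponent le_top K hK
  have hWsq : MemLp (fun y => ‖W y‖ ^ 2) 2 (volume.restrict K) := by
    simpa only [sq, smul_eq_mul, Pi.mul_def] using hW2.norm.smul (hW K hK).norm
  exact (((hd K hK).norm.add (hW2.norm.const_mul 2)).add hWsq).add (hV K hK).norm

theorem decaysLike_coeffSize {μ : ℝ} (hμ : 0 ≤ μ) (hW : DecaysLike μ W) (hV : DecaysLike μ V)
    (hd : DecaysLike μ d) : DecaysLike μ (coeffSize W V d) := by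
  have hWsq : DecaysLike μ fun y => ‖W y‖ * ‖W y‖ :=
    (hW.norm.mul hW.norm).mono (le_add_of_nonneg_left hμ)
  simpa only [DecaysLike, coeffSize, two_mul, sq] using
    ((hd.norm.add (hW.norm.add hW.norm)).add hWsq).add hV.norm

theorem locallyIntegrable_source
    (hD : IsWeakDiv (mulField W f) fun x => d x * f x + ∑ i, W x i * g x i)
    (hfg : IsWeakGrad f g) (hW : MemLpLoc W ⊤ volume) (hV : MemLpLoc V 2 volume)
    (hd : MemLpLoc d 2 volume) (hf : MemLpLoc f 2 volume) (hg : MemLpLoc g 2 volume) :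
    LocallyIntegrable (source W V f) := by
  have hmeas : AEStronglyMeasurable (source W V f) volume := by
    have hWm := (hW.locallyIntegrable le_top).aestronglyMeasurable
    have hVm := (hV.locallyIntegrable one_le_two).aestronglyMeasurable
    have hdm := (hd.locallyIntegrable one_le_two).aestronglyMeasurable
    have hWg : LocallyIntegrable fun y => ∑ i, (W y i : ℂ) * g y i :=
      locallyIntegrable_finsetSum _ fun i _ => (hg.apply i).locallyIntegrable_smul
        (h := fun y => (W y i : ℂ)) fun K hK =>
          ((hW.mono_exponent le_top).apply (𝕜 := ℝ) i K hK).ofReal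
    refine AEStronglyMeasurable.congr ?_ (source_ae_eq hD hfg).symm
    refine .add (.mul (.sub (.const_mul ?_ _) ?_) hfg.1.aestronglyMeasurable)
      (hWg.aestronglyMeasurable.const_mul _)
    · exact Complex.continuous_ofReal.comp_aestronglyMeasurable hdm
    · exact Complex.continuous_ofReal.comp_aestronglyMeasurable ((hWm.norm.pow 2).add hVm)
  have hF : MemLpLoc (fun y => ‖f y‖ + ‖g y‖) 2 volume :=
    fun K hK => (hf K hK).norm.add (hg K hK).norm
  refine (hF.locallyIntegrable_smul (memLpLoc_coeffSize hW hV hd)).mono hmeas ?_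
  filter_upwards [norm_source_le (V := V) hD hfg] with y hy
  exact hy.trans (le_abs_self _)

theorem memWeightedLpAtInfty_source {μ δ₀ : ℝ} (hμ : 0 ≤ μ)
    (hD : IsWeakDiv (mulField W f) fun x => d x * f x + ∑ i, W x i * g x i)
    (hfg : IsWeakGrad f g) (hS : AEStronglyMeasurable (source W V f) volume)
    (hW : DecaysLike μ W) (hV : DecaysLike μ V) (hd : DecaysLike μ d)
    (hf : MemWeightedLp 2 (-δ₀) f) (hg : MemWeightedLp 2 (-δ₀) g) :
    MemWeightedLpAtInfty 2 (μ - δ₀) (source W V f) := by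
  obtain ⟨C, R, hC⟩ := (decaysLike_coeffSize hμ hW hV hd).exists_norm_weight_mul_le hμ
  refine ⟨R, ((hf.norm.add hg.norm).restrict _).of_le_mul (c := C)
    ((continuous_weight _).aestronglyMeasurable.smul hS).restrict ?_⟩
  filter_upwards [ae_restrict_of_ae hC, ae_restrict_of_ae (norm_source_le (V := V) hD hfg),
    ae_restrict_mem Metric.isClosed_closedBall.measurableSet.compl] with y hCy hSy hy
  rw [mem_compl_iff, mem_closedBall_zero_iff, not_le] at hy
  have hw : ∀ σ, ‖weight σ y‖ = weight σ y := fun σ => Real.norm_of_nonneg (weight_pos σ y).le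
  have hnorm : ∀ {F : Type} [NormedAddCommGroup F] [NormedSpace ℝ F] (v : F),
      ‖((1 + ‖y‖ ^ 2) ^ (-δ₀ / 2) : ℝ) • v‖ = weight (-δ₀) y * ‖v‖ := fun v => by
    rw [norm_smul, ← hw]; rfl
  have hbound := (le_abs_self _).trans (hCy hy.le)
  rw [Pi.add_apply, hnorm, hnorm, norm_smul, hw, sub_eq_add_neg, weight_add, ← mul_add,
    Real.norm_of_nonneg (mul_nonneg (weight_pos _ _).le (by positivity))]
  calc weight μ y * weight (-δ₀) y * ‖source W V f y‖
      ≤ weight μ y * weight (-δ₀) y * (coeffSize W V d y * (‖f y‖ + ‖g y‖)) := by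
        gcongr
        exact mul_nonneg (weight_pos _ _).le (weight_pos _ _).le
    _ = weight μ y * coeffSize W V d y * (weight (-δ₀) y * (‖f y‖ + ‖g y‖)) := by ring
    _ ≤ C * (weight (-δ₀) y * (‖f y‖ + ‖g y‖)) :=
        mul_le_mul_of_nonneg_right hbound (mul_nonneg (weight_pos _ _).le (by positivity))

end Source

/-! ### The kernel near its singularity -/

section NearField

theorem integrableOn_and_setIntegral_norm_sub_rpow {E : Type*} [NormedAddCommGroup E]
    [NormedSpace ℝ E] [FiniteDimensional ℝ E] [Nontrivial E] [MeasurableSpace E] [BorelSpace E]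
    (μ : Measure E) [μ.IsAddHaarMeasure] (x : E) {ρ : ℝ} (hρ : 0 ≤ ρ) :
    IntegrableOn (fun y => ‖x - y‖ ^ (1 - (Module.finrank ℝ E : ℝ))) (Metric.closedBall x ρ) μ ∧
      ∫ y in Metric.closedBall x ρ, ‖x - y‖ ^ (1 - (Module.finrank ℝ E : ℝ)) ∂μ
        = Module.finrank ℝ E * μ.real (Metric.ball 0 1) * ρ := by
  set d := Module.finrank ℝ E
  have hd : 1 ≤ d := Module.finrank_pos
  set φ : ℝ → ℝ := (Iic ρ).indicator fun r => r ^ (1 - (d : ℝ))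
  have hball : (Metric.closedBall x ρ).indicator (fun y => ‖x - y‖ ^ (1 - (d : ℝ)))
      = fun y => φ ‖x - y‖ := by
    ext y
    simp only [φ, indicator, mem_closedBall_iff_norm', mem_Iic]
  have hrad : ∀ r ∈ Ioi (0 : ℝ), r ^ (d - 1) • φ r = (Iic ρ).indicator (fun _ => (1 : ℝ)) r := by
    intro r hr
    simp only [φ, indicator, smul_eq_mul, mul_ite, mul_zero]
    rw [← Real.rpow_natCast, ← Real.rpow_add hr, Nat.cast_sub hd]
    simp
  have hint : IntegrableOn (fun r : ℝ => r ^ (d - 1) • φ r) (Ioi 0) := by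
    rw [integrableOn_congr_fun hrad measurableSet_Ioi, IntegrableOn,
      integrable_indicator_iff measurableSet_Iic, IntegrableOn,
      Measure.restrict_restrict measurableSet_Iic, Iic_inter_Ioi]
    exact integrableOn_const (by simp)
  have hval : ∫ r in Ioi (0 : ℝ), r ^ (d - 1) • φ r = ρ := by
    rw [setIntegral_congr_fun measurableSet_Ioi hrad, integral_indicator measurableSet_Iic,
      Measure.restrict_restrict measurableSet_Iic, Iic_inter_Ioi]
    simp [hρ]
  rw [← integrable_indicator_iff measurableSet_closedBall,
    ← integral_indicator measurableSet_closedBall, hball]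
  refine ⟨((integrable_fun_norm_addHaar μ).2 hint).comp_sub_left x, ?_⟩
  rw [integral_sub_left_eq_self (fun y => φ ‖y‖) μ x, integral_fun_norm_addHaar, hval]
  simp [d, mul_assoc]

variable {n : ℕ} {k a : ℝ} {S : Rn n → ℂ}

theorem aestronglyMeasurable_greenFn_norm_sub (n : ℕ) (k : ℝ) (x : Rn n) :
    AEStronglyMeasurable (fun y => greenFn n k ‖x - y‖) volume :=
  ((measurable_greenFn n k).comp (by fun_prop : Measurable fun y : Rn n => ‖x - y‖))
    |>.aestronglyMeasurable

theorem exists_setIntegral_sq_norm_greenFn_le (hn : 1 ≤ n) (hn3 : n ≤ 3) (hk : 0 < k) :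
    ∃ C, ∀ (x : Rn n) (ρ : ℝ), 0 ≤ ρ →
      MemLp (fun y => greenFn n k ‖x - y‖) 2 (volume.restrict (Metric.closedBall x ρ)) ∧
      ∫ y in Metric.closedBall x ρ, ‖greenFn n k ‖x - y‖‖ ^ 2 ≤ C * ρ := by
  have : Nonempty (Fin n) := ⟨⟨0, hn⟩⟩
  obtain ⟨C, hC⟩ := exists_rpow_mul_norm_greenFn_le hn hn3 hk
  refine ⟨C ^ 2 * (n * (volume : Measure (Rn n)).real (Metric.ball 0 1)), fun x ρ hρ => ?_⟩
  obtain ⟨hint, hval⟩ := integrableOn_and_setIntegral_norm_sub_rpow volume x hρ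
  rw [finrank_euclideanSpace_fin] at hint hval
  have hle : ∀ᵐ y ∂volume.restrict (Metric.closedBall x ρ),
      ‖greenFn n k ‖x - y‖‖ ^ 2 ≤ C ^ 2 * ‖x - y‖ ^ (1 - (n : ℝ)) := by
    filter_upwards [ae_restrict_of_ae (Measure.ae_ne volume x)] with y hyx
    have hr : 0 < ‖x - y‖ := norm_sub_pos_iff.2 hyx.symm
    have hsq : (‖x - y‖ ^ (((n : ℝ) - 1) / 2)) ^ 2 * ‖x - y‖ ^ (1 - (n : ℝ)) = 1 := by
      rw [← Real.rpow_mul_natCast hr.le, ← Real.rpow_add hr]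
      norm_num
    calc ‖greenFn n k ‖x - y‖‖ ^ 2
        = (‖x - y‖ ^ (((n : ℝ) - 1) / 2) * ‖greenFn n k ‖x - y‖‖) ^ 2
          * ‖x - y‖ ^ (1 - (n : ℝ)) := by
          linear_combination -‖greenFn n k ‖x - y‖‖ ^ 2 * hsq
      _ ≤ C ^ 2 * ‖x - y‖ ^ (1 - (n : ℝ)) := by gcongr; exact hC _ hr
  have hmeas := (aestronglyMeasurable_greenFn_norm_sub n k x).restrict
    (s := Metric.closedBall x ρ)
  have hsq : IntegrableOn (fun y => ‖greenFn n k ‖x - y‖‖ ^ 2) (Metric.closedBall x ρ) :=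
    (hint.const_mul (C ^ 2)).mono' (hmeas.norm.pow 2) <| hle.mono fun y hy => by
      rwa [Real.norm_of_nonneg (sq_nonneg _)]
  refine ⟨(memLp_two_iff_integrable_sq_norm hmeas).2 hsq, ?_⟩
  calc _ ≤ ∫ y in Metric.closedBall x ρ, C ^ 2 * ‖x - y‖ ^ (1 - (n : ℝ)) :=
        integral_mono_ae hsq (hint.const_mul _) hle
    _ = _ := by rw [integral_const_mul, hval]; ring

theorem half_norm_le_of_mem_closedBall {x y : Rn n} (hy : y ∈ Metric.closedBall x (‖x‖ / 2)) :
    ‖x‖ / 2 ≤ ‖y‖ := by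
  rw [mem_closedBall_iff_norm'] at hy
  linarith [norm_sub_norm_le x y]

theorem norm_le_rpow_mul_norm_weight_smul {F : Type} [NormedAddCommGroup F] [NormedSpace ℝ F]
    (ha : 0 ≤ a) {x y : Rn n} (hx : 0 < ‖x‖) (hy : ‖x‖ / 2 ≤ ‖y‖) (v : F) :
    ‖v‖ ≤ ‖x‖ ^ (-a) * (2 ^ a * ‖weight a y • v‖) := by
  have hw : (‖x‖ / 2) ^ a ≤ weight a y :=
    (Real.rpow_le_rpow (by positivity) hy ha).trans (norm_rpow_le_weight ha y)
  rw [norm_smul, Real.norm_of_nonneg (weight_pos a y).le, Real.rpow_neg hx.le]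
  calc ‖v‖ = (‖x‖ ^ a)⁻¹ * (2 ^ a * ((‖x‖ / 2) ^ a * ‖v‖)) := by
        rw [Real.div_rpow hx.le two_pos.le]; field_simp
    _ ≤ _ := by gcongr

theorem MemWeightedLpAtInfty.exists_setIntegral_sq_norm_le (hS : MemWeightedLpAtInfty 2 a S)
    (ha : 0 ≤ a) :
    ∃ M R : ℝ, ∀ x : Rn n, R < ‖x‖ →
      MemLp S 2 (volume.restrict (Metric.closedBall x (‖x‖ / 2))) ∧
      ∫ y in Metric.closedBall x (‖x‖ / 2), ‖S y‖ ^ 2 ≤ M * (‖x‖ ^ (-a)) ^ 2 := by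
  obtain ⟨R, hR⟩ := hS
  have hwS : IntegrableOn (fun y => (2 ^ a * ‖weight a y • S y‖) ^ 2) (Metric.closedBall 0 R)ᶜ :=
    (hR.norm.const_mul (2 ^ a)).integrable_sq
  refine ⟨∫ y in (Metric.closedBall 0 R)ᶜ, (2 ^ a * ‖weight a y • S y‖) ^ 2,
    max 0 (2 * R), fun x hx => ?_⟩
  obtain ⟨hx0, hxR⟩ := max_lt_iff.1 hx
  have hsub : Metric.closedBall x (‖x‖ / 2) ⊆ (Metric.closedBall 0 R)ᶜ := fun y hy => by
    rw [mem_compl_iff, mem_closedBall_zero_iff, not_le]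
    linarith [half_norm_le_of_mem_closedBall hy]
  have hle : ∀ y ∈ Metric.closedBall x (‖x‖ / 2),
      ‖S y‖ ≤ ‖x‖ ^ (-a) * (2 ^ a * ‖weight a y • S y‖) := fun y hy =>
    norm_le_rpow_mul_norm_weight_smul ha hx0 (half_norm_le_of_mem_closedBall hy) (S y)
  have hmeas : AEStronglyMeasurable S (volume.restrict (Metric.closedBall x (‖x‖ / 2))) :=
    ((continuous_weight (-a)).aestronglyMeasurable.smul (hR.1.mono_set hsub)).congr
      (Eventually.of_forall fun y => weight_neg_smul_weight_smul a y (S y))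
  have hS2 : MemLp S 2 (volume.restrict (Metric.closedBall x (‖x‖ / 2))) := by
    refine (hR.mono_measure (Measure.restrict_mono_set _ hsub)).of_le_mul
      (c := ‖x‖ ^ (-a) * 2 ^ a) hmeas ?_
    filter_upwards [ae_restrict_mem measurableSet_closedBall] with y hy
    rw [mul_assoc]
    exact hle y hy
  refine ⟨hS2, ?_⟩
  calc ∫ y in Metric.closedBall x (‖x‖ / 2), ‖S y‖ ^ 2
      ≤ ∫ y in Metric.closedBall x (‖x‖ / 2),
          (2 ^ a * ‖weight a y • S y‖) ^ 2 * (‖x‖ ^ (-a)) ^ 2 := by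
        refine setIntegral_mono_on ((memLp_two_iff_integrable_sq_norm hmeas).1 hS2)
          ((hwS.mono_set hsub).mul_const _) measurableSet_closedBall fun y hy => ?_
        rw [mul_comm, ← mul_pow]
        gcongr
        exact hle y hy
    _ ≤ _ := by
        rw [integral_mul_const]
        exact mul_le_mul_of_nonneg_right (setIntegral_mono_set hwS
          (Eventually.of_forall fun y => sq_nonneg _) hsub.eventuallyLE) (sq_nonneg _)

theorem exists_setIntegral_norm_greenFn_mul_le (hn : 1 ≤ n) (hn3 : n ≤ 3) (hk : 0 < k)
    (hS : MemWeightedLpAtInfty 2 a S) (ha : 0 ≤ a) :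
    ∃ K R : ℝ, ∀ x : Rn n, R < ‖x‖ →
      IntegrableOn (fun y => greenFn n k ‖x - y‖ * S y) (Metric.closedBall x (‖x‖ / 2)) ∧
      ∫ y in Metric.closedBall x (‖x‖ / 2), ‖greenFn n k ‖x - y‖ * S y‖
        ≤ K * ‖x‖ ^ (1 / 2 - a) := by
  obtain ⟨C, hC⟩ := exists_setIntegral_sq_norm_greenFn_le hn hn3 hk
  obtain ⟨M, R, hM⟩ := hS.exists_setIntegral_sq_norm_le ha
  refine ⟨√(C / 2) * √M, max 0 R, fun x hx => ?_⟩
  obtain ⟨hx0, hxR⟩ := max_lt_iff.1 hx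
  obtain ⟨hG2, hG⟩ := hC x (‖x‖ / 2) (by positivity)
  obtain ⟨hS2, hS⟩ := hM x hxR
  refine ⟨memLp_one_iff_integrable.1 (hS2.smul hG2), ?_⟩
  have hCS := integral_mul_norm_le_Lp_mul_Lq (μ := volume.restrict (Metric.closedBall x (‖x‖ / 2)))
    (p := 2) (q := 2) (.two_two) (by simpa using hG2) (by simpa using hS2)
  simp only [Real.rpow_two, ← Real.sqrt_eq_rpow] at hCS
  simp only [norm_mul]
  calc _ ≤ √(C * (‖x‖ / 2)) * √(M * (‖x‖ ^ (-a)) ^ 2) :=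
        hCS.trans (by gcongr)
    _ = √(C / 2) * √M * ‖x‖ ^ (1 / 2 - a) := by
        rw [show C * (‖x‖ / 2) = C / 2 * ‖x‖ by ring, Real.sqrt_mul' _ hx0.le,
          Real.sqrt_mul' _ (sq_nonneg _), Real.sqrt_sq (by positivity), sub_eq_add_neg,
          Real.rpow_add hx0, ← Real.sqrt_eq_rpow]
        ring

end NearField

/-! ### Pointwise asymptotics of the kernel -/

section InnerProductSpace

variable {E : Type*} [NormedAddCommGroup E] [InnerProductSpace ℝ E]

theorem abs_norm_sub_sub_norm_add_inner_le {x : E} (hx : x ≠ 0) (y : E) :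
    |‖x - y‖ - ‖x‖ + ⟪‖x‖⁻¹ • x, y⟫_ℝ| ≤ 2 * ‖y‖ ^ 2 * ‖x‖⁻¹ := by
  have hx0 : 0 < ‖x‖ := norm_pos_iff.2 hx
  set t := ⟪‖x‖⁻¹ • x, y⟫_ℝ with ht
  have ht1 : |t| ≤ ‖y‖ := by
    simpa [norm_smul, hx0.ne'] using abs_real_inner_le_norm (‖x‖⁻¹ • x) y
  have hdiff : |‖x - y‖ - ‖x‖| ≤ ‖y‖ := by simpa using abs_norm_sub_norm_le (x - y) x
  have hprod : (‖x - y‖ - ‖x‖ + t) * (‖x - y‖ + ‖x‖) = ‖y‖ ^ 2 + t * (‖x - y‖ - ‖x‖) := by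
    have hxt : ⟪x, y⟫_ℝ = ‖x‖ * t := by rw [ht, real_inner_smul_left]; field_simp
    linear_combination norm_sub_sq_real x y - 2 * hxt
  rw [← div_eq_mul_inv, le_div_iff₀ hx0]
  calc |‖x - y‖ - ‖x‖ + t| * ‖x‖ ≤ |‖x - y‖ - ‖x‖ + t| * (‖x - y‖ + ‖x‖) := by
        gcongr; exact le_add_of_nonneg_left (norm_nonneg _)
    _ = |‖y‖ ^ 2 + t * (‖x - y‖ - ‖x‖)| := by
        rw [← hprod, abs_mul, abs_of_nonneg (by positivity : 0 ≤ ‖x - y‖ + ‖x‖)]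
    _ ≤ ‖y‖ ^ 2 + ‖y‖ * ‖y‖ := by
        refine (abs_add_le _ _).trans (add_le_add (abs_of_nonneg (sq_nonneg _)).le ?_)
        rw [abs_mul]
        gcongr
    _ = 2 * ‖y‖ ^ 2 := by ring

theorem tendsto_norm_sub_sub_norm_add_inner (y : E) :
    Tendsto (fun x : E => ‖x - y‖ - ‖x‖ + ⟪‖x‖⁻¹ • x, y⟫_ℝ) (cobounded E) (𝓝 0) := by
  refine squeeze_zero_norm' (a := fun x => 2 * ‖y‖ ^ 2 * ‖x‖⁻¹) ?_ ?_
  · filter_upwards [tendsto_norm_cobounded_atTop.eventually (eventually_gt_atTop 0)] with x hx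
    exact abs_norm_sub_sub_norm_add_inner_le (norm_pos_iff.1 hx) y
  · simpa using tendsto_norm_cobounded_atTop.inv_tendsto_atTop.const_mul (2 * ‖y‖ ^ 2)

end InnerProductSpace

section NormedGroup

variable {E : Type*} [NormedAddCommGroup E]

theorem tendsto_norm_sub_cobounded (y : E) :
    Tendsto (fun x : E => ‖x - y‖) (cobounded E) atTop :=
  tendsto_atTop_mono (fun x => norm_sub_norm_le x y)
    (tendsto_atTop_add_const_right _ _ tendsto_norm_cobounded_atTop)

theorem tendsto_norm_div_norm_sub (y : E) :
    Tendsto (fun x : E => ‖x‖ / ‖x - y‖) (cobounded E) (𝓝 1) := by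
  rw [tendsto_iff_norm_sub_tendsto_zero]
  have hlim : Tendsto (fun x : E => ‖y‖ * ‖x - y‖⁻¹) (cobounded E) (𝓝 0) := by
    simpa using (tendsto_norm_sub_cobounded y).inv_tendsto_atTop.const_mul ‖y‖
  refine squeeze_zero' (Eventually.of_forall fun _ => norm_nonneg _) ?_ hlim
  filter_upwards [(tendsto_norm_sub_cobounded y).eventually (eventually_gt_atTop 0)] with x hx
  rw [div_sub_one hx.ne', norm_div, norm_norm, ← div_eq_mul_inv]
  gcongr
  simpa using abs_norm_sub_norm_le x (x - y)

end NormedGroup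

section FarField

variable {n : ℕ} {k a : ℝ} {S : Rn n → ℂ}

/-- `e^{ik(|x| - (θ', y))}` with `θ' = x / |x|`, the leading behaviour of `e^{ik|x - y|}` as
`|x| → ∞`. -/
noncomputable def farFieldWave (k : ℝ) (x y : Rn n) : ℂ :=
  Complex.exp (Complex.I * k * ‖x‖) * Complex.exp (-(Complex.I * k * (⟪‖x‖⁻¹ • x, y⟫_ℝ : ℝ)))

/-- The factor `c_n k^{(n-3)/2}` of the far field expansion. -/
noncomputable def farFieldAmplitude (n : ℕ) (k : ℝ) : ℂ :=
  farFieldConst n * ((k ^ (((n : ℝ) - 3) / 2) : ℝ) : ℂ)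

theorem norm_farFieldWave (k : ℝ) (x y : Rn n) : ‖farFieldWave k x y‖ = 1 := by
  rw [farFieldWave, norm_mul, Complex.norm_exp, Complex.norm_exp]
  simp

theorem continuous_farFieldWave (k : ℝ) (x : Rn n) : Continuous (farFieldWave k x) := by
  unfold farFieldWave
  fun_prop

theorem tendsto_exp_mul_farFieldWave (k : ℝ) (y : Rn n) :
    Tendsto (fun x => Complex.exp (-Complex.I * (k * ‖x - y‖ : ℝ)) * farFieldWave k x y)
      (cobounded (Rn n)) (𝓝 1) := by
  have hexp : Continuous fun τ : ℝ => Complex.exp (-(Complex.I * k * (τ : ℂ))) := by fun_prop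
  have hlim := (hexp.tendsto 0).comp (tendsto_norm_sub_sub_norm_add_inner y)
  simp only [Complex.ofReal_zero, mul_zero, neg_zero, Complex.exp_zero] at hlim
  refine hlim.congr fun x => ?_
  rw [farFieldWave, Function.comp_apply, ← Complex.exp_add, ← Complex.exp_add]
  congr 1
  push_cast
  ring

theorem tendsto_rpow_mul_greenFn_norm_sub (hn : 1 ≤ n) (hn3 : n ≤ 3) (hk : 0 < k) (y : Rn n) :
    Tendsto (fun x : Rn n => ((‖x‖ ^ (((n : ℝ) - 1) / 2) : ℝ) : ℂ)
        * (Complex.exp (-Complex.I * (k * ‖x - y‖ : ℝ)) * greenFn n k ‖x - y‖))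
      (cobounded (Rn n)) (𝓝 (farFieldAmplitude n k)) := by
  have hratio : Tendsto (fun x : Rn n => (((‖x‖ / ‖x - y‖) ^ (((n : ℝ) - 1) / 2) : ℝ) : ℂ))
      (cobounded (Rn n)) (𝓝 1) := by
    have h := (tendsto_norm_div_norm_sub y).rpow_const (p := ((n : ℝ) - 1) / 2)
      (Or.inl one_ne_zero)
    rw [Real.one_rpow] at h
    exact_mod_cast (Complex.continuous_ofReal.tendsto 1).comp h
  have hlim := hratio.mul
    ((tendsto_rpow_mul_greenFn hn hn3 hk).comp (tendsto_norm_sub_cobounded y))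
  rw [one_mul] at hlim
  refine hlim.congr' ?_
  filter_upwards [(tendsto_norm_sub_cobounded y).eventually (eventually_gt_atTop 0)] with x hx
  have hxr : (‖x‖ / ‖x - y‖) ^ (((n : ℝ) - 1) / 2) * ‖x - y‖ ^ (((n : ℝ) - 1) / 2)
      = ‖x‖ ^ (((n : ℝ) - 1) / 2) := by
    rw [← Real.mul_rpow (by positivity) hx.le, div_mul_cancel₀ _ hx.ne']
  rw [← hxr, Complex.ofReal_mul, Function.comp_apply]
  ring

theorem tendsto_rpow_mul_greenFn_sub_farFieldWave (hn : 1 ≤ n) (hn3 : n ≤ 3) (hk : 0 < k)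
    (y : Rn n) :
    Tendsto (fun x : Rn n => ((‖x‖ ^ (((n : ℝ) - 1) / 2) : ℝ) : ℂ) * greenFn n k ‖x - y‖
        - farFieldAmplitude n k * farFieldWave k x y) (cobounded (Rn n)) (𝓝 0) := by
  have hlim := ((tendsto_rpow_mul_greenFn_norm_sub hn hn3 hk y).sub
    ((tendsto_exp_mul_farFieldWave k y).const_mul (farFieldAmplitude n k))).norm
  rw [mul_one, sub_self, norm_zero] at hlim
  rw [tendsto_zero_iff_norm_tendsto_zero]
  refine hlim.congr fun x => ?_
  have hone : ‖Complex.exp (-Complex.I * (k * ‖x - y‖ : ℝ))‖ = 1 := by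
    rw [Complex.norm_exp]; simp
  rw [mul_left_comm, mul_left_comm (farFieldAmplitude n k), ← mul_sub, norm_mul, hone, one_mul]

/-! ### The far field expansion -/

theorem tendsto_rpow_mul_setIntegral_greenFn (hn : 1 ≤ n) (hn3 : n ≤ 3) (hk : 0 < k)
    (ha : (n : ℝ) / 2 < a) (hS : MemWeightedLpAtInfty 2 a S) :
    Tendsto (fun x : Rn n => ((‖x‖ ^ (((n : ℝ) - 1) / 2) : ℝ) : ℂ)
        * ∫ y in Metric.closedBall x (‖x‖ / 2), greenFn n k ‖x - y‖ * S y)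
      (cobounded (Rn n)) (𝓝 0) := by
  obtain ⟨K, R, hK⟩ := exists_setIntegral_norm_greenFn_mul_le hn hn3 hk hS
    (le_trans (by positivity) ha.le)
  have hlim : Tendsto (fun x : Rn n => K * ‖x‖ ^ (-(a - (n : ℝ) / 2))) (cobounded (Rn n))
      (𝓝 0) := by
    simpa using ((tendsto_rpow_neg_atTop (sub_pos.2 ha)).comp
      tendsto_norm_cobounded_atTop).const_mul K
  refine squeeze_zero_norm' ?_ hlim
  filter_upwards [tendsto_norm_cobounded_atTop.eventually (eventually_gt_atTop (max 0 R))]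
    with x hx
  obtain ⟨hx0, hxR⟩ := max_lt_iff.1 hx
  rw [norm_mul, Complex.norm_real, Real.norm_of_nonneg (by positivity)]
  calc _ ≤ ‖x‖ ^ (((n : ℝ) - 1) / 2) * (K * ‖x‖ ^ (1 / 2 - a)) := by
        gcongr
        exact (norm_integral_le_integral_norm _).trans (hK x hxR).2
    _ = K * ‖x‖ ^ (-(a - (n : ℝ) / 2)) := by
        rw [mul_left_comm, ← Real.rpow_add hx0]
        ring_nf

theorem exists_rpow_mul_norm_greenFn_norm_sub_le (hn : 1 ≤ n) (hn3 : n ≤ 3) (hk : 0 < k) :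
    ∃ C, ∀ x : Rn n, 0 < ‖x‖ → ∀ y ∉ Metric.closedBall x (‖x‖ / 2),
      ‖x‖ ^ (((n : ℝ) - 1) / 2) * ‖greenFn n k ‖x - y‖‖ ≤ C := by
  obtain ⟨C, hC⟩ := exists_rpow_mul_norm_greenFn_le hn hn3 hk
  have hs : 0 ≤ ((n : ℝ) - 1) / 2 := by
    have : (1 : ℝ) ≤ n := by exact_mod_cast hn
    linarith
  refine ⟨2 ^ (((n : ℝ) - 1) / 2) * C, fun x hx y hy => ?_⟩
  rw [mem_closedBall_iff_norm', not_le] at hy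
  have hr : 0 < ‖x - y‖ := by linarith
  calc ‖x‖ ^ (((n : ℝ) - 1) / 2) * ‖greenFn n k ‖x - y‖‖
      ≤ (2 * ‖x - y‖) ^ (((n : ℝ) - 1) / 2) * ‖greenFn n k ‖x - y‖‖ := by
        gcongr; linarith
    _ = 2 ^ (((n : ℝ) - 1) / 2) * (‖x - y‖ ^ (((n : ℝ) - 1) / 2) * ‖greenFn n k ‖x - y‖‖) := by
        rw [Real.mul_rpow two_pos.le hr.le, mul_assoc]
    _ ≤ _ := by gcongr; exact hC _ hr

theorem eventually_integrable_greenFn_mul (hn : 1 ≤ n) (hn3 : n ≤ 3) (hk : 0 < k) (ha : 0 ≤ a)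
    (hS : Integrable S) (hinf : MemWeightedLpAtInfty 2 a S) :
    ∀ᶠ x in cobounded (Rn n), Integrable fun y => greenFn n k ‖x - y‖ * S y := by
  obtain ⟨K, R, hK⟩ := exists_setIntegral_norm_greenFn_mul_le hn hn3 hk hinf ha
  obtain ⟨C, hC⟩ := exists_rpow_mul_norm_greenFn_norm_sub_le hn hn3 hk
  filter_upwards [tendsto_norm_cobounded_atTop.eventually (eventually_gt_atTop (max 0 R))]
    with x hx
  obtain ⟨hx0, hxR⟩ := max_lt_iff.1 hx
  rw [← integrableOn_univ, ← union_compl_self (Metric.closedBall x (‖x‖ / 2))]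
  refine (hK x hxR).1.union ?_
  refine hS.integrableOn.bdd_mul (aestronglyMeasurable_greenFn_norm_sub n k x).restrict
    (c := C / ‖x‖ ^ (((n : ℝ) - 1) / 2)) ?_
  filter_upwards [ae_restrict_mem measurableSet_closedBall.compl] with y hy
  rw [le_div_iff₀' (by positivity)]
  exact hC x hx0 y hy

theorem isCountablyGenerated_cobounded {E : Type*} [SeminormedAddGroup E] :
    (cobounded E).IsCountablyGenerated := by
  rw [← comap_norm_atTop]
  infer_instance

theorem tendsto_setIntegral_compl_greenFn_sub_farFieldWave (hn : 1 ≤ n) (hn3 : n ≤ 3)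
    (hk : 0 < k) (hS : Integrable S) :
    Tendsto (fun x : Rn n => ∫ y in (Metric.closedBall x (‖x‖ / 2))ᶜ,
        (((‖x‖ ^ (((n : ℝ) - 1) / 2) : ℝ) : ℂ) * greenFn n k ‖x - y‖
          - farFieldAmplitude n k * farFieldWave k x y) * S y) (cobounded (Rn n)) (𝓝 0) := by
  have := isCountablyGenerated_cobounded (E := Rn n)
  obtain ⟨C, hC⟩ := exists_rpow_mul_norm_greenFn_norm_sub_le hn hn3 hk
  simp only [← integral_indicator measurableSet_closedBall.compl]
  rw [← integral_zero (Rn n) ℂ (μ := volume)]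
  refine tendsto_integral_filter_of_dominated_convergence
    (fun y => (|C| + ‖farFieldAmplitude n k‖) * ‖S y‖) (Eventually.of_forall fun x => ?_) ?_
    (hS.norm.const_mul _) (Eventually.of_forall fun y => ?_)
  · exact ((((aestronglyMeasurable_greenFn_norm_sub n k x).const_mul _).sub
      ((continuous_farFieldWave k x).aestronglyMeasurable.const_mul _)).mul hS.1).indicator
        measurableSet_closedBall.compl
  · filter_upwards [tendsto_norm_cobounded_atTop.eventually (eventually_gt_atTop 0)] with x hx
    refine Eventually.of_forall fun y => ?_
    rw [norm_indicator_eq_indicator_norm]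
    refine indicator_apply_le' (fun hy => ?_) fun _ => by positivity
    rw [norm_mul]
    refine mul_le_mul_of_nonneg_right ((norm_sub_le _ _).trans (add_le_add ?_ ?_))
      (norm_nonneg _)
    · rw [norm_mul, Complex.norm_real, Real.norm_of_nonneg (by positivity)]
      exact (hC x hx y hy).trans (le_abs_self C)
    · rw [norm_mul, norm_farFieldWave, mul_one]
  · have hlim := ((tendsto_rpow_mul_greenFn_sub_farFieldWave hn hn3 hk y).mul_const (S y)).norm
    rw [zero_mul, norm_zero] at hlim
    exact squeeze_zero_norm (fun x => norm_indicator_le_norm_self _ _) hlim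

theorem tendsto_setIntegral_closedBall_half_farFieldWave (k : ℝ) (hS : Integrable S) :
    Tendsto (fun x : Rn n => ∫ y in Metric.closedBall x (‖x‖ / 2), farFieldWave k x y * S y)
      (cobounded (Rn n)) (𝓝 0) := by
  have := isCountablyGenerated_cobounded (E := Rn n)
  simp only [← integral_indicator measurableSet_closedBall]
  rw [← integral_zero (Rn n) ℂ (μ := volume)]
  refine tendsto_integral_filter_of_dominated_convergence (fun y => ‖S y‖)
    (Eventually.of_forall fun x => ?_)
    (Eventually.of_forall fun x => Eventually.of_forall fun y => ?_) hS.norm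
    (Eventually.of_forall fun y => tendsto_const_nhds.congr' ?_)
  · exact ((continuous_farFieldWave k x).aestronglyMeasurable.mul hS.1).indicator
      measurableSet_closedBall
  · exact (norm_indicator_le_norm_self _ _).trans (by rw [norm_mul, norm_farFieldWave, one_mul])
  · filter_upwards [tendsto_norm_cobounded_atTop.eventually (eventually_gt_atTop (2 * ‖y‖))]
      with x hx
    refine (indicator_of_notMem (fun hy => ?_) _).symm
    linarith [half_norm_le_of_mem_closedBall hy]

theorem tendsto_rpow_mul_integral_greenFn_sub (hn : 1 ≤ n) (hn3 : n ≤ 3) (hk : 0 < k)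
    (ha : (n : ℝ) / 2 < a) (hS : Integrable S) (hinf : MemWeightedLpAtInfty 2 a S) :
    Tendsto (fun x : Rn n => ((‖x‖ ^ (((n : ℝ) - 1) / 2) : ℝ) : ℂ)
        * (∫ y, greenFn n k ‖x - y‖ * S y)
        - farFieldAmplitude n k * ∫ y, farFieldWave k x y * S y) (cobounded (Rn n)) (𝓝 0) := by
  have hlim := ((tendsto_rpow_mul_setIntegral_greenFn hn hn3 hk ha hinf).add
    (tendsto_setIntegral_compl_greenFn_sub_farFieldWave hn hn3 hk hS)).sub
    ((tendsto_setIntegral_closedBall_half_farFieldWave k hS).const_mul (farFieldAmplitude n k))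
  simp only [mul_zero, add_zero, sub_zero] at hlim
  refine hlim.congr' ?_
  filter_upwards [eventually_integrable_greenFn_mul hn hn3 hk
    (le_trans (by positivity) ha.le) hS hinf] with x hG
  have hE : Integrable fun y => farFieldWave k x y * S y :=
    hS.bdd_mul (continuous_farFieldWave k x).aestronglyMeasurable (c := 1)
      (Eventually.of_forall fun y => (norm_farFieldWave k x y).le)
  simp only [sub_mul, mul_assoc]
  rw [integral_sub (hG.const_mul _).integrableOn (hE.const_mul _).integrableOn,
    integral_const_mul, integral_const_mul,
    ← integral_add_compl (measurableSet_closedBall (x := x) (ε := ‖x‖ / 2)) hG,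
    ← integral_add_compl (measurableSet_closedBall (x := x) (ε := ‖x‖ / 2)) hE]
  ring

theorem isLittleO_integral_greenFn_sub (hn : 1 ≤ n) (hn3 : n ≤ 3) (hk : 0 < k)
    (ha : (n : ℝ) / 2 < a) (hS : Integrable S) (hinf : MemWeightedLpAtInfty 2 a S) :
    (fun x : Rn n =>
        (∫ y, greenFn n k ‖x - y‖ * S y)
          - farFieldConst n
            * (Complex.exp (Complex.I * (k : ℂ) * (‖x‖ : ℂ))
                * ((k ^ (((n : ℝ) - 3) / 2) : ℝ) : ℂ)
                / ((‖x‖ ^ (((n : ℝ) - 1) / 2) : ℝ) : ℂ))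
            * ∫ y, Complex.exp (-(Complex.I * (k : ℂ) * ((inner ℝ (‖x‖⁻¹ • x) y : ℝ) : ℂ))) * S y)
      =o[cobounded (Rn n)] fun x : Rn n => 1 / ‖x‖ ^ (((n : ℝ) - 1) / 2) := by
  have hO : (fun x : Rn n => (((‖x‖ ^ (((n : ℝ) - 1) / 2) : ℝ) : ℂ))⁻¹)
      =O[cobounded (Rn n)] fun x => 1 / ‖x‖ ^ (((n : ℝ) - 1) / 2) :=
    .of_norm_le fun x => by
      rw [one_div, norm_inv, Complex.norm_real, Real.norm_of_nonneg (by positivity)]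
  have ho := hO.mul_isLittleO
    ((isLittleO_one_iff ℝ).2 (tendsto_rpow_mul_integral_greenFn_sub hn hn3 hk ha hS hinf))
  simp only [mul_one] at ho
  refine ho.congr' ?_ .rfl
  filter_upwards [tendsto_norm_cobounded_atTop.eventually (eventually_gt_atTop 0)] with x hx
  have hxs : ((‖x‖ ^ (((n : ℝ) - 1) / 2) : ℝ) : ℂ) ≠ 0 :=
    Complex.ofReal_ne_zero.2 (by positivity)
  simp only [farFieldWave, farFieldAmplitude, mul_assoc, integral_const_mul]
  field_simp

end FarField

end MagneticScattering

theorem lemma2p3_general (n : ℕ) (hn : 1 ≤ n) (hn3 : n ≤ 3) (p : ℝ≥0∞) (hp : 2 ≤ p)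
    (δ μ : ℝ) (hμ : 0 ≤ μ) (W : Rn n → Rn n) (V : Rn n → ℝ) (hWV : Admissible p δ μ W V)
    (δ₀ : ℝ) (hδ₀μ : (n : ℝ) / 2 < μ - δ₀) (k : ℝ) (hk : 0 < k)
    (f : Rn n → ℂ) (hf : MemWeightedH1 (-δ₀) f) :
    (∃ d : Rn n → ℂ, IsWeakDiv (mulField W f) d) ∧
    Integrable (source W V f) volume ∧
    (∀ᶠ x in cobounded (Rn n),
      Integrable (fun y => greenFn n k ‖x - y‖ * source W V f y) volume) ∧
    (fun x : Rn n =>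
        Lk W V k f x
          - farFieldConst n
            * (Complex.exp (Complex.I * (k : ℂ) * (‖x‖ : ℂ))
                * ((k ^ (((n : ℝ) - 3) / 2) : ℝ) : ℂ)
                / ((‖x‖ ^ (((n : ℝ) - 1) / 2) : ℝ) : ℂ))
            * farFieldIntegral W V k f (‖x‖⁻¹ • x))
      =o[cobounded (Rn n)] fun x : Rn n => 1 / ‖x‖ ^ (((n : ℝ) - 1) / 2) := by
  obtain ⟨hf2, g, hfg, hg2⟩ := hf
  obtain ⟨d, hdiv, hdp, hddec⟩ := hWV.divW
  have hW : MemLpLoc W ⊤ volume := hWV.W_mem.memLpLoc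
  have hV : MemLpLoc V 2 volume := MemLpLoc.mono_exponent hWV.V_mem hp
  have hd : MemLpLoc d 2 volume := hdp.memLpLoc.mono_exponent hp
  have hD := isWeakDiv_mulField hdiv hfg (hW.mono_exponent le_top) hd hf2.memLpLoc hg2.memLpLoc
  have hSloc : LocallyIntegrable (source W V f) :=
    locallyIntegrable_source hD hfg hW hV hd hf2.memLpLoc hg2.memLpLoc
  have hSinf : MemWeightedLpAtInfty 2 (μ - δ₀) (source W V f) :=
    memWeightedLpAtInfty_source hμ hD hfg hSloc.aestronglyMeasurable hWV.W_decay hWV.V_decay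
      hddec hf2 hg2
  have hS : Integrable (source W V f) := integrable_of_memWeightedLpAtInfty hSloc hδ₀μ hSinf
  exact ⟨⟨_, hD⟩, hS,
    eventually_integrable_greenFn_mul hn hn3 hk (le_trans (by positivity) hδ₀μ.le) hS hSinf,
    isLittleO_integral_greenFn_sub hn hn3 hk hδ₀μ hS hSinf⟩

theorem lemma2p3 (n : ℕ) (hn : n = 2 ∨ n = 3)
    (p : ℝ≥0∞) (hp3 : n = 3 → 3 ≤ p) (hp2 : n = 2 → 2 < p)
    (δ : ℝ) (hδ : ((n : ℝ) + 1) / 2 - (n : ℝ) * (p⁻¹).toReal < δ)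
    (μ : ℝ) (hμ : 2 < μ)
    (W : Rn n → Rn n) (V : Rn n → ℝ) (hWV : Admissible p δ μ W V)
    (δ₀ : ℝ) (hδ₀ : 1 / 2 < δ₀) (hδ₀μ : 2 * δ₀ + 1 < μ)
    (k : ℝ) (hk : 0 < k) (f : Rn n → ℂ) (hf : MemWeightedH1 (-δ₀) f) :
    -- all the terms of the expansion are well defined
    (∃ d : Rn n → ℂ, IsWeakDiv (mulField W f) d) ∧
    Integrable (source W V f) volume ∧
    (∀ᶠ x in cobounded (Rn n),
      Integrable (fun y => greenFn n k ‖x - y‖ * source W V f y) volume) ∧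
    -- the expansion, uniformly in the direction of `x`
    (fun x : Rn n =>
        Lk W V k f x
          - farFieldConst n
            * (Complex.exp (Complex.I * (k : ℂ) * (‖x‖ : ℂ))
                * ((k ^ (((n : ℝ) - 3) / 2) : ℝ) : ℂ)
                / ((‖x‖ ^ (((n : ℝ) - 1) / 2) : ℝ) : ℂ))
            * farFieldIntegral W V k f (‖x‖⁻¹ • x))
      =o[cobounded (Rn n)] fun x : Rn n => 1 / ‖x‖ ^ (((n : ℝ) - 1) / 2) := by
  have hn3 : (n : ℝ) ≤ 3 := by exact_mod_cast (by omega : n ≤ 3)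
  have hp : 2 ≤ p := hn.elim (fun h => (hp2 h).le) fun h => le_trans (by norm_num) (hp3 h)
  exact lemma2p3_general n (by omega) (by omega) p hp δ μ (by linarith) W V hWV δ₀ (by linarith)
    k hk f hf
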